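/- Let $A$ be a second countable compact Hausdorff space, $X$ a compact Hausdorff space, both with their Borel $\sigma$-algebras $\mathfrak A_A$, $\mathfrak A_X$, let $\mu$ be a probability measure on $(X,\mathfrak A_X)$ and let $H$ be a separable complex Hilbert space. A $\mathcal B(H)$-valued quantum probability measure on $A$ is a map $E:\mathfrak A_A\to\mathcal B(H)^+$ with $E(\emptyset)=0$, $E(A)=I$ that is countably additive in the strong operator topology; for $\xi,\eta\in H$ put $E_{\xi,\eta}(\alpha)=\langle E(\alpha)\xi,\eta\rangle$, a complex measure. An information channel from $X$ to $A$ is a family $E=(E(\cdot|x))_{x\in X}$ of quantum probability measures on $A$ such that $x\mapsto\langle E(\alpha|x)\xi,\eta\rangle$ is measurable for all $\alpha\in\mathfrak A_A$, $\xi,\eta\in H$. Two channels $E,F$ are equivalent if for every $\alpha\in\mathfrak A_A$ one has $E(\alpha|x)=F(\alpha|x)$ for $\mu$-a.e. $x$; the classes $\dot E$ are the information channels mod $\mu$, and they form the set $\mathfrak C_\mu(A,X;H)$. Let $L^\infty_\sigma(X,\mu,\mathcal B(H))$ be the C*-algebra of weakly measurable functions $g:X\to\mathcal B(H)$ with $\operatorname{ess\,sup}_x\|g(x)\|<\infty$,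 modulo $\mu$-a.e. equality, with pointwise operations and the essential supremum norm. Theorem. For every $\dot E\in\mathfrak C_\mu(A,X;H)$ there is a unique unital completely positive map $\Phi_{\dot E}:C(A)\to L^\infty_\sigma(X,\mu,\mathcal B(H))$ such that for all $f\in C(A)$ and all $\xi,\eta\in H$ $$\langle\Phi_{\dot E}(f)(x)\xi,\eta\rangle=\int_A f(a)\,dE_{\xi,\eta}(a|x)\qquad\text{for }\mu\text{-a.e. }x\in X,$$ for every representative $E$ of $\dot E$. Conversely, for every unital completely positive map $\Phi:C(A)\to L^\infty_\sigma(X,\mu,\mathcal B(H))$ there is a unique $\dot E\in\mathfrak C_\mu(A,X;H)$ such that $\Phi=\Phi_{\dot E}$. -/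

import Mathlib

open MeasureTheory Filter Topology
open scoped ComplexOrder CStarAlgebra ENNReal

noncomputable section

namespace OpChannel

section FunctionAlgebra

variable {X : Type*} [MeasurableSpace X]
  {H : Type*} [NormedAddCommGroup H] [InnerProductSpace ℂ H]

/-- Weak measurability of an operator-valued function: all matrix coefficients
`x ↦ ⟨f(x) ξ, η⟩` are measurable. -/
def WeaklyMeasurable (f : X → H →L[ℂ] H) : Prop :=
  ∀ ξ η : H, Measurable fun x => inner ℂ η (f x ξ)

/-- In a separable Hilbert space, the inner product of two weakly measurable functions is
measurable. -/
theorem measurable_inner_of_weak [CompleteSpace H] [TopologicalSpace.SeparableSpace H]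
    {u v : X → H} (hu : ∀ η : H, Measurable fun x => inner ℂ η (u x))
    (hv : ∀ η : H, Measurable fun x => inner ℂ η (v x)) :
    Measurable fun x => inner ℂ (u x) (v x) := by
  obtain ⟨w, b, hb⟩ := exists_hilbertBasis ℂ H
  have hcount : Countable w := by
    have h1 : Orthonormal ℂ (b : w → H) := b.orthonormal
    have h2 : ∀ i j : w, i ≠ j → 1 ≤ dist (b i) (b j) := by
      intro i j hij
      have h3 : ‖b i - b j‖ ^ 2 = 2 := by
        rw [@norm_sub_sq ℂ, h1.1 i, h1.1 j, h1.2 hij]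
        norm_num
      rw [dist_eq_norm]
      nlinarith [norm_nonneg (b i - b j)]
    have h4 : Pairwise (fun i j : w => Disjoint (Metric.ball (b i) (1 / 2))
        (Metric.ball (b j) (1 / 2))) := by
      intro i j hij
      apply Metric.ball_disjoint_ball
      have := h2 i j hij
      linarith
    exact Pairwise.countable_of_isOpen_disjoint h4 (fun i => Metric.isOpen_ball)
      (fun i => ⟨b i, Metric.mem_ball_self (by norm_num)⟩)
  have hsum : ∀ x, HasSum (fun i => inner ℂ (u x) (b i) * inner ℂ (b i) (v x))
      (inner ℂ (u x) (v x)) := fun x => b.hasSum_inner_mul_inner (u x) (v x)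
  refine measurable_of_tendsto_metrizable' (atTop : Filter (Finset w))
    (f := fun s x => ∑ i ∈ s, inner ℂ (u x) (b i) * inner ℂ (b i) (v x)) ?_
    (tendsto_pi_nhds.mpr hsum)
  intro s
  refine Finset.measurable_fun_sum s fun i _ => Measurable.mul ?_ (hv (b i))
  have : (fun x => inner ℂ (u x) (b i)) = fun x => star (inner ℂ (b i) (u x)) := by
    funext x
    exact (inner_conj_symm (u x) (b i)).symm
  rw [this]
  exact continuous_star.measurable.comp (hu (b i))

variable (μ : Measure X) (H)

/-- The `*`-algebra, under pointwise operations, of weakly measurable functions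
`X → B(H)` with `ess sup ‖f(x)‖ < ∞`. -/
def EssBdd [CompleteSpace H] [TopologicalSpace.SeparableSpace H] :
    StarSubalgebra ℂ (X → H →L[ℂ] H) where
  carrier := {f | WeaklyMeasurable f ∧ essSup (fun x => ‖f x‖ₑ) μ < ∞}
  mul_mem' := by
    rintro f g ⟨hf, hf'⟩ ⟨hg, hg'⟩
    refine ⟨fun ξ η => ?_, ?_⟩
    · have h : (fun x => inner ℂ η ((f * g) x ξ))
          = fun x => inner ℂ (star (f x) η) (g x ξ) := by
        funext x
        exact (ContinuousLinearMap.adjoint_inner_left (f x) (g x ξ) η).symm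
      rw [h]
      refine measurable_inner_of_weak (fun ζ => ?_) (fun ζ => hg ξ ζ)
      have h2 : (fun x => inner ℂ ζ (star (f x) η)) = fun x => star (inner ℂ η (f x ζ)) := by
        funext x
        rw [ContinuousLinearMap.star_eq_adjoint, ContinuousLinearMap.adjoint_inner_right]
        exact (inner_conj_symm (f x ζ) η).symm
      rw [h2]
      exact continuous_star.measurable.comp (hf ζ η)
    · refine lt_of_le_of_lt (essSup_le_of_ae_le (essSup (fun x => ‖f x‖ₑ) μ *
        essSup (fun x => ‖g x‖ₑ) μ) ?_) (ENNReal.mul_lt_top hf' hg')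
      filter_upwards [ENNReal.ae_le_essSup (μ := μ) (fun x => ‖f x‖ₑ),
        ENNReal.ae_le_essSup (μ := μ) (fun x => ‖g x‖ₑ)] with x h1 h2
      calc ‖(f * g) x‖ₑ ≤ ‖f x‖ₑ * ‖g x‖ₑ := by
            simp only [enorm_eq_nnnorm, Pi.mul_apply]
            exact_mod_cast nnnorm_mul_le _ _
        _ ≤ _ := mul_le_mul' h1 h2
  add_mem' := by
    rintro f g ⟨hf, hf'⟩ ⟨hg, hg'⟩
    refine ⟨fun ξ η => ?_, ?_⟩
    · have h : (fun x => inner ℂ η ((f + g) x ξ))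
          = fun x => inner ℂ η (f x ξ) + inner ℂ η (g x ξ) := by
        funext x
        simp
      rw [h]
      exact (hf ξ η).add (hg ξ η)
    · refine lt_of_le_of_lt (essSup_le_of_ae_le (essSup (fun x => ‖f x‖ₑ) μ +
        essSup (fun x => ‖g x‖ₑ) μ) ?_) (ENNReal.add_lt_top.mpr ⟨hf', hg'⟩)
      filter_upwards [ENNReal.ae_le_essSup (μ := μ) (fun x => ‖f x‖ₑ),
        ENNReal.ae_le_essSup (μ := μ) (fun x => ‖g x‖ₑ)] with x h1 h2
      exact (enorm_add_le _ _).trans (add_le_add h1 h2)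
  algebraMap_mem' := by
    intro c
    refine ⟨fun ξ η => ?_, ?_⟩
    · have h : (fun x : X => inner ℂ η ((algebraMap ℂ (X → H →L[ℂ] H) c) x ξ))
          = fun _ => inner ℂ η (algebraMap ℂ (H →L[ℂ] H) c ξ) := by
        funext x
        rfl
      rw [h]
      exact measurable_const
    · exact lt_of_le_of_lt (essSup_le_of_ae_le ‖algebraMap ℂ (H →L[ℂ] H) c‖ₑ
        (Eventually.of_forall fun x => le_rfl)) enorm_lt_top
  star_mem' := by
    rintro f ⟨hf, hf'⟩
    refine ⟨fun ξ η => ?_, ?_⟩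
    · have h2 : (fun x => inner ℂ η ((star f) x ξ)) = fun x => star (inner ℂ ξ (f x η)) := by
        funext x
        rw [Pi.star_apply, ContinuousLinearMap.star_eq_adjoint,
          ContinuousLinearMap.adjoint_inner_right]
        exact (inner_conj_symm (f x η) ξ).symm
      rw [h2]
      exact continuous_star.measurable.comp (hf η ξ)
    · have : (fun x => ‖(star f) x‖ₑ) = fun x => ‖f x‖ₑ := by
        funext x
        simp only [enorm_eq_nnnorm, Pi.star_apply, nnnorm_star]
      rw [this]
      exact hf'

variable [CompleteSpace H] [TopologicalSpace.SeparableSpace H]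

/-- Almost everywhere equality as a ring congruence. -/
def aeCon : RingCon (EssBdd H μ) where
  r f g := (f : X → H →L[ℂ] H) =ᵐ[μ] g
  iseqv := ⟨fun _ => EventuallyEq.rfl, fun h => h.symm, fun h h' => h.trans h'⟩
  mul' h h' := h.mul h'
  add' h h' := h.add h'

/-- `L^∞_σ(X, μ, B(H))`: essentially bounded weakly measurable functions modulo
almost everywhere equality. -/
def LinftySigma : Type _ := (aeCon H μ).Quotient

namespace LinftySigma

instance : Ring (LinftySigma H μ) := inferInstanceAs (Ring (aeCon H μ).Quotient)

instance : Algebra ℂ (LinftySigma H μ) := inferInstanceAs (Algebra ℂ (aeCon H μ).Quotient)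

variable {H μ}

/-- The class of a function modulo almost everywhere equality. -/
def mk (f : EssBdd H μ) : LinftySigma H μ := Quotient.mk (aeCon H μ).toSetoid f

theorem mk_surjective : Function.Surjective (mk : EssBdd H μ → LinftySigma H μ) :=
  Quotient.mk_surjective

theorem mk_eq_mk {f g : EssBdd H μ} :
    mk f = mk g ↔ (f : X → H →L[ℂ] H) =ᵐ[μ] g := Quotient.eq

theorem mk_add (f g : EssBdd H μ) : mk (f + g) = mk f + mk g := rfl
theorem mk_mul (f g : EssBdd H μ) : mk (f * g) = mk f * mk g := rfl
theorem mk_neg (f : EssBdd H μ) : mk (-f) = -mk f := rfl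
theorem mk_sub (f g : EssBdd H μ) : mk (f - g) = mk f - mk g := rfl
theorem mk_zero : mk (0 : EssBdd H μ) = 0 := rfl
theorem mk_one : mk (1 : EssBdd H μ) = 1 := rfl
theorem mk_smul (c : ℂ) (f : EssBdd H μ) : mk (c • f) = c • mk f := rfl

instance : Star (LinftySigma H μ) where
  star := Quotient.map (fun f : EssBdd H μ => star f) fun _ _ h => EventuallyEq.fun_comp h star

theorem mk_star (f : EssBdd H μ) : mk (star f) = star (mk f) := rfl

instance : StarRing (LinftySigma H μ) where
  star_involutive a := by
    obtain ⟨f, rfl⟩ := mk_surjective a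
    rw [← mk_star, ← mk_star, star_star]
  star_mul a b := by
    obtain ⟨f, rfl⟩ := mk_surjective a
    obtain ⟨g, rfl⟩ := mk_surjective b
    rw [← mk_star, ← mk_star, ← mk_mul, ← mk_mul, ← mk_star, star_mul]
  star_add a b := by
    obtain ⟨f, rfl⟩ := mk_surjective a
    obtain ⟨g, rfl⟩ := mk_surjective b
    rw [← mk_star, ← mk_star, ← mk_add, ← mk_add, ← mk_star, star_add]

instance : StarModule ℂ (LinftySigma H μ) where
  star_smul c a := by
    obtain ⟨f, rfl⟩ := mk_surjective a
    rw [← mk_star, ← mk_smul, ← mk_smul, ← mk_star, star_smul]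

/-- The norm is the essential supremum of `x ↦ ‖f(x)‖`. -/
instance : Norm (LinftySigma H μ) where
  norm := Quotient.lift
    (fun f : EssBdd H μ => (essSup (fun x => ‖(f : X → H →L[ℂ] H) x‖ₑ) μ).toReal)
    fun _ _ h => congrArg ENNReal.toReal (essSup_congr_ae (EventuallyEq.fun_comp h enorm))

theorem norm_mk (f : EssBdd H μ) :
    ‖mk f‖ = (essSup (fun x => ‖(f : X → H →L[ℂ] H) x‖ₑ) μ).toReal := rfl

theorem norm_mk_nonneg (f : EssBdd H μ) : 0 ≤ ‖mk f‖ := ENNReal.toReal_nonneg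

theorem norm_mk_le_iff {f : EssBdd H μ} {C : ℝ} (hC : 0 ≤ C) :
    ‖mk f‖ ≤ C ↔ ∀ᵐ x ∂μ, ‖(f : X → H →L[ℂ] H) x‖ ≤ C := by
  constructor
  · intro h
    filter_upwards [ENNReal.ae_le_essSup (μ := μ) fun x => ‖(f : X → H →L[ℂ] H) x‖ₑ] with x hx
    have h1 := ENNReal.toReal_mono f.2.2.ne hx
    rw [toReal_enorm] at h1
    exact h1.trans h
  · intro h
    refine ENNReal.toReal_le_of_le_ofReal hC (essSup_le_of_ae_le _ ?_)
    filter_upwards [h] with x hx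
    rw [← ofReal_norm]
    exact ENNReal.ofReal_le_ofReal hx

theorem ae_norm_le (f : EssBdd H μ) : ∀ᵐ x ∂μ, ‖(f : X → H →L[ℂ] H) x‖ ≤ ‖mk f‖ :=
  (norm_mk_le_iff (norm_mk_nonneg f)).1 le_rfl

/-- The essential supremum norm, bundled. -/
def addGroupNorm : AddGroupNorm (LinftySigma H μ) where
  toFun a := ‖a‖
  map_zero' := by
    refine le_antisymm ?_ (norm_mk_nonneg (0 : EssBdd H μ))
    refine (norm_mk_le_iff (f := (0 : EssBdd H μ)) le_rfl).2 (Eventually.of_forall fun x => ?_)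
    simp
  add_le' a b := by
    obtain ⟨f, rfl⟩ := mk_surjective a
    obtain ⟨g, rfl⟩ := mk_surjective b
    rw [← mk_add]
    refine (norm_mk_le_iff (add_nonneg (norm_mk_nonneg f) (norm_mk_nonneg g))).2 ?_
    filter_upwards [ae_norm_le f, ae_norm_le g] with x h1 h2
    exact (norm_add_le _ _).trans (add_le_add h1 h2)
  neg' a := by
    obtain ⟨f, rfl⟩ := mk_surjective a
    rw [← mk_neg, norm_mk, norm_mk]
    congr 2
    funext x
    exact enorm_neg _
  eq_zero_of_map_eq_zero' a h := by
    obtain ⟨f, rfl⟩ := mk_surjective a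
    rw [← mk_zero, mk_eq_mk]
    filter_upwards [(norm_mk_le_iff le_rfl).1 h.le] with x hx
    exact norm_le_zero_iff.1 hx

instance : NormedRing (LinftySigma H μ) where
  __ := (inferInstance : Ring (LinftySigma H μ))
  __ := addGroupNorm.toNormedAddCommGroup
  toNorm := inferInstance
  norm_mul_le a b := by
    obtain ⟨f, rfl⟩ := mk_surjective a
    obtain ⟨g, rfl⟩ := mk_surjective b
    rw [← mk_mul]
    refine (norm_mk_le_iff (mul_nonneg (norm_mk_nonneg f) (norm_mk_nonneg g))).2 ?_
    filter_upwards [ae_norm_le f, ae_norm_le g] with x h1 h2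
    exact (norm_mul_le _ _).trans (mul_le_mul h1 h2 (norm_nonneg _) (norm_mk_nonneg f))

instance : NormedAlgebra ℂ (LinftySigma H μ) where
  norm_smul_le c a := by
    obtain ⟨f, rfl⟩ := mk_surjective a
    rw [← mk_smul]
    refine (norm_mk_le_iff (mul_nonneg (norm_nonneg c) (norm_mk_nonneg f))).2 ?_
    filter_upwards [ae_norm_le f] with x h1
    exact (norm_smul_le _ _).trans (mul_le_mul_of_nonneg_left h1 (norm_nonneg c))

instance : CStarRing (LinftySigma H μ) where
  norm_mul_self_le a := by
    obtain ⟨f, rfl⟩ := mk_surjective a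
    rw [← mk_star, ← mk_mul]
    set N := ‖mk (star f * f)‖ with hN
    have hN0 : 0 ≤ N := norm_mk_nonneg _
    have h : ‖mk f‖ ≤ √N := by
      refine (norm_mk_le_iff (Real.sqrt_nonneg _)).2 ?_
      filter_upwards [ae_norm_le (star f * f)] with x hx
      refine Real.le_sqrt_of_sq_le ?_
      rw [sq]
      have h2 : ‖star ((f : X → H →L[ℂ] H) x) * (f : X → H →L[ℂ] H) x‖ ≤ N := hx
      rwa [CStarRing.norm_star_mul_self] at h2
    calc ‖mk f‖ * ‖mk f‖ ≤ √N * √N :=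
          mul_le_mul h h (norm_mk_nonneg f) (Real.sqrt_nonneg _)
      _ = N := Real.mul_self_sqrt hN0

instance : CompleteSpace (LinftySigma H μ) := by
  refine Metric.complete_of_cauchySeq_tendsto fun u hu => ?_
  choose f hf using fun n => mk_surjective (u n)
  have hae : ∀ᵐ x ∂μ, ∀ n m, ‖(f n : X → H →L[ℂ] H) x - (f m : X → H →L[ℂ] H) x‖
      ≤ ‖u n - u m‖ := by
    rw [ae_all_iff]
    intro n
    rw [ae_all_iff]
    intro m
    have h := ae_norm_le (f n - f m)
    rw [mk_sub, hf, hf] at h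
    exact h
  obtain ⟨S, hSsub, hSmeas, hS0⟩ := exists_measurable_superset_of_null (ae_iff.1 hae)
  have hSae : ∀ᵐ x ∂μ, x ∉ S := by
    rw [ae_iff]
    simpa using hS0
  have hS : ∀ x, x ∉ S → ∀ n m, ‖(f n : X → H →L[ℂ] H) x - (f m : X → H →L[ℂ] H) x‖
      ≤ ‖u n - u m‖ := by
    intro x hx
    by_contra hcon
    exact hx (hSsub hcon)
  have hcauchy : ∀ x, x ∉ S → CauchySeq fun n => (f n : X → H →L[ℂ] H) x := by
    intro x hx
    rw [Metric.cauchySeq_iff] at hu ⊢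
    intro ε hε
    obtain ⟨N, hN⟩ := hu ε hε
    refine ⟨N, fun m hm n hn => ?_⟩
    rw [dist_eq_norm]
    refine lt_of_le_of_lt (hS x hx m n) ?_
    rw [← dist_eq_norm]
    exact hN m hm n hn
  classical
  have hlim : ∀ x, ∃ T : H →L[ℂ] H,
      Tendsto (fun n => if x ∈ S then 0 else (f n : X → H →L[ℂ] H) x) atTop (𝓝 T) := by
    intro x
    by_cases hx : x ∈ S
    · refine ⟨0, ?_⟩
      simp only [hx, if_true]
      exact tendsto_const_nhds
    · simp only [hx, if_false]
      exact cauchySeq_tendsto_of_complete (hcauchy x hx)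
  choose g hg using hlim
  have hclose : ∀ ε > 0, ∃ N, ∀ n ≥ N, ∀ x, x ∉ S → ‖(f n : X → H →L[ℂ] H) x - g x‖ ≤ ε := by
    intro ε hε
    obtain ⟨N, hN⟩ := Metric.cauchySeq_iff.1 hu ε hε
    refine ⟨N, fun n hn x hx => ?_⟩
    have h1 := hg x
    simp only [hx, if_false] at h1
    refine le_of_tendsto (tendsto_const_nhds.sub h1).norm ?_
    filter_upwards [eventually_ge_atTop N] with m hm
    refine (hS x hx n m).trans ?_
    rw [← dist_eq_norm]
    exact (hN n hn m hm).le
  have hgmem : g ∈ EssBdd H μ := by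
    refine ⟨fun ξ η => ?_, ?_⟩
    · refine measurable_of_tendsto_metrizable (f := fun n x =>
        if x ∈ S then 0 else inner ℂ η ((f n : X → H →L[ℂ] H) x ξ)) (fun n =>
          Measurable.ite hSmeas measurable_const ((f n).2.1 ξ η)) (tendsto_pi_nhds.2 fun x => ?_)
      have hc : Continuous fun T : H →L[ℂ] H => inner ℂ η (T ξ) := by fun_prop
      have h2 := (hc.tendsto _).comp (hg x)
      refine h2.congr fun n => ?_
      by_cases hx : x ∈ S <;> simp [hx]
    · obtain ⟨N, hN⟩ := hclose 1 one_pos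
      refine lt_of_le_of_lt (essSup_le_of_ae_le (ENNReal.ofReal (1 + ‖mk (f N)‖)) ?_)
        ENNReal.ofReal_lt_top
      filter_upwards [hSae, ae_norm_le (f N)] with x hx hx2
      rw [← ofReal_norm]
      refine ENNReal.ofReal_le_ofReal ?_
      have h3 := norm_sub_norm_le (g x) ((f N : X → H →L[ℂ] H) x)
      have h4 := hN N le_rfl x hx
      rw [norm_sub_rev] at h4
      linarith
  refine ⟨mk ⟨g, hgmem⟩, Metric.tendsto_atTop.2 fun ε hε => ?_⟩
  obtain ⟨N, hN⟩ := hclose (ε / 2) (half_pos hε)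
  refine ⟨N, fun n hn => ?_⟩
  rw [dist_eq_norm, ← hf n, ← mk_sub]
  refine lt_of_le_of_lt ((norm_mk_le_iff (half_pos hε).le).2 ?_) (half_lt_self hε)
  filter_upwards [hSae] with x hx
  exact hN n hn x hx

instance : CStarAlgebra (LinftySigma H μ) where

/-- The order of `L^∞_σ(X, μ, B(H))` as a C⋆-algebra. -/
instance : PartialOrder (LinftySigma H μ) := CStarAlgebra.spectralOrder _

instance : StarOrderedRing (LinftySigma H μ) := CStarAlgebra.spectralOrderedRing _

end LinftySigma

end FunctionAlgebra

section Channels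

variable (A : Type*) [MeasurableSpace A]
  (H : Type*) [NormedAddCommGroup H] [InnerProductSpace ℂ H]

/-- A `B(H)`-valued quantum probability measure on `A`. As for Mathlib's vector measures, the value
on a set that is not measurable is `0` by convention; this only serves extensionality. -/
structure QuantumMeasure where
  /-- The operator `E(δ)`. -/
  toFun : Set A → H →L[ℂ] H
  not_measurable' : ∀ δ, ¬ MeasurableSet δ → toFun δ = 0
  isPositive' : ∀ δ, MeasurableSet δ → (toFun δ).IsPositive
  empty' : toFun ∅ = 0
  univ' : toFun Set.univ = 1
  /-- Countable additivity in the strong operator topology. -/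
  iUnion' : ∀ δ : ℕ → Set A, (∀ n, MeasurableSet (δ n)) → Pairwise (Function.onFun Disjoint δ) →
    ∀ ξ : H, HasSum (fun n => toFun (δ n) ξ) (toFun (⋃ n, δ n) ξ)

instance : CoeFun (QuantumMeasure A H) fun _ => Set A → H →L[ℂ] H := ⟨QuantumMeasure.toFun⟩

variable {A H}

/-- The scalar complex measure `E_{ξ,η}(δ) = ⟨E(δ) ξ, η⟩` (the inner product of Mathlib is linear
in its second argument). -/
def QuantumMeasure.coeff (E : QuantumMeasure A H) (ξ η : H) : ComplexMeasure A where
  measureOf' δ := inner ℂ η (E δ ξ)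
  empty' := by simp [E.empty']
  not_measurable' δ hδ := by simp [E.not_measurable' δ hδ]
  m_iUnion' δ hδ hd := (E.iUnion' δ hδ hd ξ).mapL (innerSL ℂ η)

variable (X : Type*) [MeasurableSpace X]

variable (A H) in
/-- A `B(H)`-valued information channel from `X` to `A`: a weakly measurable family
`x ↦ E(· | x)` of quantum probability measures. -/
structure Channel where
  /-- The quantum probability measure `E(· | x)`. -/
  toFun : X → QuantumMeasure A H
  measurable' : ∀ α, MeasurableSet α → WeaklyMeasurable fun x => toFun x α

instance : CoeFun (Channel A H X) fun _ => X → QuantumMeasure A H := ⟨Channel.toFun⟩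

variable {X} (μ : Measure X)

variable (A H) in
/-- `E ∼ F` when, for every measurable `α`, `E(α | x) = F(α | x)` for `μ`-almost every `x`. -/
def Channel.setoid : Setoid (Channel A H X) where
  r E F := ∀ α, MeasurableSet α → ∀ᵐ x ∂μ, E x α = F x α
  iseqv := ⟨fun _ _ _ => Eventually.of_forall fun _ => rfl,
    fun h α hα => (h α hα).mono fun _ hx => hx.symm,
    fun h h' α hα => by filter_upwards [h α hα, h' α hα] with x h1 h2 using h1.trans h2⟩

variable (A H) in
/-- `B(H)`-valued information channels from `X` to `A` mod `μ`. -/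
def ChannelMod : Type _ := Quotient (Channel.setoid A H μ)

/-- The class mod `μ` of a channel. -/
def Channel.toMod (E : Channel A H X) : ChannelMod A H μ := Quotient.mk (Channel.setoid A H μ) E

end Channels

/-- Unital completely positive maps between unital C⋆-algebras. -/
def UCP (B₁ B₂ : Type*) [CStarAlgebra B₁] [CStarAlgebra B₂] [PartialOrder B₁] [PartialOrder B₂]
    [StarOrderedRing B₁] [StarOrderedRing B₂] : Type _ :=
  {Φ : B₁ →CP B₂ // Φ 1 = 1}

section Correspondence

variable {A : Type*} [TopologicalSpace A] [CompactSpace A] [MeasurableSpace A]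
  {X : Type*} [MeasurableSpace X] {μ : Measure X}
  {H : Type*} [NormedAddCommGroup H] [InnerProductSpace ℂ H] [CompleteSpace H]
  [TopologicalSpace.SeparableSpace H]

/-- `Φ` is given by integration against `Ė`: for all `f ∈ C(A)` and `ξ, η ∈ H`,
`⟨Φ(f)(x) ξ, η⟩ = ∫ f dE_{ξ,η}(· | x)` for `μ`-almost every `x`, whatever the representatives
`E` of `Ė` and `g` of `Φ(f)`. -/
def IsGivenBy (Φ : UCP C(A, ℂ) (LinftySigma H μ)) (Edot : ChannelMod A H μ) : Prop :=
  ∀ E : Channel A H X, E.toMod μ = Edot → ∀ (f : C(A, ℂ)) (g : EssBdd H μ),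
    LinftySigma.mk g = Φ.1 f → ∀ ξ η : H, ∀ᵐ x ∂μ,
      inner ℂ η ((g : X → H →L[ℂ] H) x ξ) =
        ((E x).coeff ξ η).integral (fun a => f a) (ContinuousLinearMap.mul ℝ ℂ)

end Correspondence

end OpChannel

end

/-! From channel to map: for fixed `x` the complex measures `E_{ξ,η}(· | x)` are dominated by
`E_{ξ,ξ} + E_{η,η}`, so a bounded measurable `f` has an operator integral `∫ f dE(· | x)`, weakly
measurable in `x`. It is positive for `f ≥ 0` and unital. Since `C(A)` is commutative, positivity
already gives complete positivity (`map_cstarMatrix_nonneg_of_positive`): partitions of unity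
approximate each matrix `φ(star (g i) * g j)` by sums of positive scalar rank-one matrices times
positive elements. As `H` is separable, matrix coefficients determine a class in `L^∞_σ`, whence
uniqueness of the map.

From map to channel: the obstacle is that `Φ(f)(x)` is defined only up to a null set depending on
`f`. Second countability makes `C(A)` separable, so linearity, unitality and positivity on a
countable dense set amount to countably many almost-everywhere norm inequalities. Off one null set
these extend to a unital positive map `φ x : C(A) → B(H)` (`exists_pointwise_positive`). For each
`x`, Riesz–Markov represents the quadratic forms of `φ x` by measures; an induction from closed to
Borel sets produces the operators `E(δ | x)`, and an operator inequality makes them strongly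
countably additive (`exists_quantumMeasure`). Another such induction gives measurability in `x`. Two
channels with the same map have equal integrals on a countable dense subset of `C(A)` off one null
set, hence the same quantum measures there. -/

noncomputable section

namespace OpChannel

/-! ### Operators from weak limits and quadratic forms; inequalities for positive operators. -/

section Hilbert

variable {H : Type*} [NormedAddCommGroup H] [InnerProductSpace ℂ H] [CompleteSpace H]

/-- A weakly convergent sequence of bounded operators has a bounded limit. -/
theorem exists_clm_of_tendsto_inner (T : ℕ → H →L[ℂ] H) (b : H → H → ℂ)
    (h : ∀ ξ η, Tendsto (fun n => inner ℂ η (T n ξ)) atTop (𝓝 (b ξ η))) :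
    ∃ S : H →L[ℂ] H, ∀ ξ η, inner ℂ η (S ξ) = b ξ η := by
  -- Banach–Steinhaus, once in each variable: `L η` shows that `b` is linear and continuous in `ξ`,
  -- while `M ξ` is the functional which Riesz duality turns into the vector `S ξ`.
  let L : H → H →L[ℂ] ℂ := fun η => continuousLinearMapOfTendsto
    (fun n => (innerSL ℂ η).comp (T n)) (f := fun ξ => b ξ η)
    (tendsto_pi_nhds.2 fun ξ => h ξ η)
  have hL : ∀ η ξ, L η ξ = b ξ η := fun _ _ => rfl
  let M : H → H →L[ℂ] ℂ := fun ξ => continuousLinearMapOfTendsto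
    (fun n => innerSL ℂ (T n ξ)) (f := fun η => star (b ξ η))
    (tendsto_pi_nhds.2 fun η => by
      have := (continuous_star.tendsto _).comp (h ξ η)
      refine this.congr fun n => ?_
      exact inner_conj_symm (T n ξ) η)
  let S : H → H := fun ξ => (InnerProductSpace.toDual ℂ H).symm (M ξ)
  have hS : ∀ ξ η, inner ℂ η (S ξ) = b ξ η := by
    intro ξ η
    rw [← inner_conj_symm, InnerProductSpace.toDual_symm_apply]
    exact star_star (b ξ η)
  let S' : H →ₗ[ℂ] H :=
    { toFun := S
      map_add' := fun x y => ext_inner_left ℂ fun η => by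
        rw [inner_add_right, hS, hS, hS, ← hL, ← hL, ← hL, map_add]
      map_smul' := fun c x => ext_inner_left ℂ fun η => by
        rw [RingHom.id_apply, inner_smul_right, hS, hS, ← hL, ← hL, map_smul, smul_eq_mul] }
  refine ⟨⟨S', ?_⟩, hS⟩
  -- Closed graph theorem: continuity of each `L η` identifies the weak limit of `S (u n)`, so no
  -- uniform bound on `T n` is needed.
  refine LinearMap.continuous_of_seq_closed_graph S' fun u x y hu hy => ?_
  refine ext_inner_left ℂ fun η => ?_
  have h1 : Tendsto (fun n => inner ℂ η (S (u n))) atTop (𝓝 (inner ℂ η y)) :=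
    tendsto_const_nhds.inner hy
  have h2 : Tendsto (fun n => inner ℂ η (S (u n))) atTop (𝓝 (inner ℂ η (S x))) := by
    simp only [hS, ← hL]
    exact ((L η).continuous.tendsto x).comp hu
  exact tendsto_nhds_unique h1 h2

omit [CompleteSpace H] in
/-- Polarization, with the operator in the second argument. -/
theorem inner_polarization (T : H →L[ℂ] H) (ξ η : H) :
    inner ℂ η (T ξ) = (inner ℂ (ξ + η) (T (ξ + η)) - inner ℂ (ξ - η) (T (ξ - η))
      + Complex.I * inner ℂ (ξ + Complex.I • η) (T (ξ + Complex.I • η))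
      - Complex.I * inner ℂ (ξ - Complex.I • η) (T (ξ - Complex.I • η))) / 4 := by
  simp only [map_add, map_sub, map_smul, inner_add_left, inner_add_right, inner_sub_left,
    inner_sub_right, inner_smul_left, inner_smul_right, Complex.conj_I]
  ring_nf
  simp only [Complex.I_sq]
  ring_nf

/-- Polarization turns convergence of the quadratic forms into weak convergence. This allows
operators to be built from the diagonal measures alone. -/
theorem exists_clm_of_tendsto_inner_self (T : ℕ → H →L[ℂ] H) (q : H → ℂ)
    (h : ∀ ξ, Tendsto (fun n => inner ℂ ξ (T n ξ)) atTop (𝓝 (q ξ))) :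
    ∃ S : H →L[ℂ] H, ∀ ξ, inner ℂ ξ (S ξ) = q ξ := by
  obtain ⟨S, hS⟩ := exists_clm_of_tendsto_inner T
    (fun ξ η => (q (ξ + η) - q (ξ - η) + Complex.I * q (ξ + Complex.I • η)
      - Complex.I * q (ξ - Complex.I • η)) / 4) (fun ξ η => by
        simp only [inner_polarization (T _) ξ η]
        exact ((((h _).sub (h _)).add ((h _).const_mul _)).sub ((h _).const_mul _)).div_const _)
  refine ⟨S, fun ξ => tendsto_nhds_unique ?_ (h ξ)⟩
  have h1 := hS ξ ξ
  rw [h1]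
  refine Tendsto.congr (fun n => (inner_polarization (T n) ξ ξ).symm) ?_
  exact ((((h _).sub (h _)).add ((h _).const_mul _)).sub ((h _).const_mul _)).div_const _

omit [CompleteSpace H] in
theorem clm_ext_inner_self {S T : H →L[ℂ] H} (h : ∀ ξ, inner ℂ ξ (S ξ) = inner ℂ ξ (T ξ)) :
    S = T := by
  refine ContinuousLinearMap.ext fun ξ => ext_inner_left ℂ fun η => ?_
  rw [inner_polarization S, inner_polarization T]
  simp only [h]

omit [CompleteSpace H] in
theorem clm_isPositive_iff_inner {T : H →L[ℂ] H} :
    T.IsPositive ↔ ∀ ξ, 0 ≤ inner ℂ ξ (T ξ) := by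
  refine ⟨fun h ξ => h.inner_nonneg_right ξ, fun h => ?_⟩
  rw [ContinuousLinearMap.isPositive_iff_complex]
  intro x
  have h1 := h x
  have h2 : inner ℂ (T x) x = inner ℂ x (T x) := by
    rw [← inner_conj_symm, Complex.conj_eq_iff_im]
    exact (Complex.nonneg_iff.1 h1).2.symm
  rw [h2]
  obtain ⟨h3, h4⟩ := Complex.nonneg_iff.1 h1
  exact ⟨Complex.ext (by simp) (by simpa using h4), h3⟩

/-- A positive operator has a square root. -/
theorem IsPositive.exists_factor {T : H →L[ℂ] H} (hT : T.IsPositive) :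
    ∃ S : H →L[ℂ] H, ∀ ξ η, inner ℂ η (T ξ) = inner ℂ (S η) (S ξ) := by
  obtain ⟨S, hS⟩ := CStarAlgebra.nonneg_iff_eq_star_mul_self.1
    ((ContinuousLinearMap.nonneg_iff_isPositive T).2 hT)
  refine ⟨S, fun ξ η => ?_⟩
  rw [hS, mul_apply_eq_comp,  ContinuousLinearMap.star_eq_adjoint,
    ContinuousLinearMap.adjoint_inner_right]

/-- Writing `T = S* S`, this is Cauchy–Schwarz followed by the arithmetic–geometric mean inequality.
The additive form is chosen because a sum of two measures can dominate a variation. -/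
theorem IsPositive.norm_inner_le {T : H →L[ℂ] H} (hT : T.IsPositive) (ξ η : H) :
    ‖(inner ℂ η (T ξ) : ℂ)‖ ≤ (inner ℂ ξ (T ξ) : ℂ).re + (inner ℂ η (T η) : ℂ).re := by
  obtain ⟨S, hS⟩ := IsPositive.exists_factor hT
  have h1 : ∀ ζ, (inner ℂ ζ (T ζ) : ℂ).re = ‖S ζ‖ ^ 2 := fun ζ => by
    rw [hS]; exact inner_self_eq_norm_sq (𝕜 := ℂ) (S ζ)
  rw [h1, h1, hS]
  have h2 := norm_inner_le_norm (𝕜 := ℂ) (S η) (S ξ)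
  nlinarith [sq_nonneg (‖S η‖ - ‖S ξ‖), sq_nonneg (‖S η‖), sq_nonneg (‖S ξ‖)]

/-- The inequality `T² ≤ T` for `0 ≤ T ≤ 1`: with `T = S* S` and `S` a contraction, `‖T ξ‖² = Re ⟨S
T ξ, S ξ⟩ ≤ ‖T ξ‖ ‖S ξ‖`. It upgrades convergence of quadratic forms to strong convergence. -/
theorem IsPositive.norm_apply_sq_le {T : H →L[ℂ] H} (hT : T.IsPositive)
    (h1 : ∀ ξ, (inner ℂ ξ (T ξ) : ℂ).re ≤ ‖ξ‖ ^ 2) (ξ : H) :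
    ‖T ξ‖ ^ 2 ≤ (inner ℂ ξ (T ξ) : ℂ).re := by
  obtain ⟨S, hS⟩ := IsPositive.exists_factor hT
  have h2 : ∀ ζ, (inner ℂ ζ (T ζ) : ℂ).re = ‖S ζ‖ ^ 2 := fun ζ => by
    rw [hS]; exact inner_self_eq_norm_sq (𝕜 := ℂ) (S ζ)
  have h3 : ∀ ζ, ‖S ζ‖ ≤ ‖ζ‖ := fun ζ => by
    have := h1 ζ
    rw [h2] at this
    exact (sq_le_sq₀ (norm_nonneg _) (norm_nonneg _)).1 this
  rw [h2]
  have h4 : ‖T ξ‖ ^ 2 = (inner ℂ (S (T ξ)) (S ξ) : ℂ).re := by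
    rw [← hS]; exact (inner_self_eq_norm_sq (𝕜 := ℂ) (T ξ)).symm
  have h5 : (inner ℂ (S (T ξ)) (S ξ) : ℂ).re ≤ ‖S (T ξ)‖ * ‖S ξ‖ :=
    (Complex.re_le_norm _).trans (norm_inner_le_norm _ _)
  have h6 : ‖S (T ξ)‖ * ‖S ξ‖ ≤ ‖T ξ‖ * ‖S ξ‖ := by gcongr; exact h3 _
  have h7 : ‖T ξ‖ ^ 2 ≤ ‖T ξ‖ * ‖S ξ‖ := by linarith
  nlinarith [norm_nonneg (T ξ), norm_nonneg (S ξ), sq_nonneg (‖T ξ‖ - ‖S ξ‖)]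

omit [CompleteSpace H] in
/-- An operator whose sesquilinear form is bounded by `C (‖ξ‖² + ‖η‖²)` has norm at most `2 C`. -/
theorem opNorm_le_of_norm_inner_le {T : H →L[ℂ] H} {C : ℝ} (hC : 0 ≤ C)
    (h : ∀ ξ η, ‖(inner ℂ η (T ξ) : ℂ)‖ ≤ C * (‖ξ‖ ^ 2 + ‖η‖ ^ 2)) : ‖T‖ ≤ 2 * C := by
  refine ContinuousLinearMap.opNorm_le_of_unit_norm (by positivity) fun ξ hξ => ?_
  rcases eq_or_ne (T ξ) 0 with h0 | h0
  · rw [h0, norm_zero]; positivity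
  -- Testing against the unit vector in the direction of `T ξ` gives `‖T ξ‖ ≤ C (1 + 1)`.
  have h1 := h ξ (((‖T ξ‖ : ℂ)⁻¹) • T ξ)
  have hn : ‖T ξ‖ ≠ 0 := norm_ne_zero_iff.2 h0
  rw [inner_smul_left, norm_smul, hξ, inner_self_eq_norm_sq_to_K] at h1
  simp at h1
  field_simp at h1
  linarith

end Hilbert

/-! ### Induction over bounded measurable functions. -/

section Induction

variable {A : Type*} [MeasurableSpace A]

/-- Induction for bounded measurable functions. -/
theorem bounded_measurable_induction {P : (A → ℂ) → Prop}
    (ind : ∀ (c : ℂ) (s : Set A), MeasurableSet s → P (s.indicator fun _ => c))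
    (add : ∀ f g : A → ℂ, Measurable f → Measurable g → (∃ C, ∀ a, ‖f a‖ ≤ C) →
      (∃ C, ∀ a, ‖g a‖ ≤ C) → P f → P g → P (f + g))
    (lim : ∀ (F : ℕ → A → ℂ) (f : A → ℂ) (C : ℝ), (∀ n, Measurable (F n)) →
      (∀ n a, ‖F n a‖ ≤ C) → (∀ a, Tendsto (fun n => F n a) atTop (𝓝 (f a))) →
      (∀ n, P (F n)) → P f)
    (f : A → ℂ) (hf : Measurable f) (hb : ∃ C, ∀ a, ‖f a‖ ≤ C) : P f := by
  have hs : ∀ s : SimpleFunc A ℂ, P s := by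
    intro s
    induction s using SimpleFunc.induction with
    | const c hs =>
      classical
      rw [SimpleFunc.coe_piecewise]
      have := ind c _ hs
      rw [← Set.piecewise_eq_indicator] at this
      exact this
    | add _ h1 h2 =>
      rename_i f g _
      rw [SimpleFunc.coe_add]
      exact add _ _ f.measurable g.measurable (SimpleFunc.exists_forall_norm_le f)
        (SimpleFunc.exists_forall_norm_le g) h1 h2
  obtain ⟨C, hC⟩ := hb
  -- Only a point of `A` forces `0 ≤ C`, which the bounded approximation requires.
  rcases isEmpty_or_nonempty A with hA | ⟨⟨a⟩⟩
  · have : f = (SimpleFunc.const A (0 : ℂ) : A → ℂ) := funext fun a => isEmptyElim a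
    rw [this]
    exact hs _
  have hC0 : 0 ≤ C := (norm_nonneg _).trans (hC a)
  have hsm := hf.stronglyMeasurable
  exact lim (fun n => hsm.approxBounded C n) f C (fun n => (hsm.approxBounded C n).measurable)
    (fun n a => hsm.norm_approxBounded_le hC0 n a)
    (fun a => hsm.tendsto_approxBounded_of_norm_le (hC a)) (fun n => hs _)

end Induction

/-! ### Integration of bounded functions against a quantum probability measure. -/

namespace QuantumMeasure

variable {A : Type*} [MeasurableSpace A]
  {H : Type*} [NormedAddCommGroup H] [InnerProductSpace ℂ H]

@[ext]
theorem ext {E F : QuantumMeasure A H} (h : ∀ δ, MeasurableSet δ → E δ = F δ) : E = F := by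
  have h1 : E.toFun = F.toFun := by
    funext δ
    by_cases hδ : MeasurableSet δ
    · exact h δ hδ
    · rw [E.not_measurable' δ hδ, F.not_measurable' δ hδ]
  cases E
  cases F
  congr

variable (E : QuantumMeasure A H)

theorem isPositive (δ : Set A) : (E δ).IsPositive := by
  by_cases hδ : MeasurableSet δ
  · exact E.isPositive' δ hδ
  · rw [E.not_measurable' δ hδ]
    exact ContinuousLinearMap.isPositive_zero

theorem inner_self_nonneg (δ : Set A) (ξ : H) : 0 ≤ (inner ℂ ξ (E δ ξ) : ℂ) :=
  (E.isPositive δ).inner_nonneg_right ξ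

/-- The positive measure `E_{ξ,ξ}`. -/
def meas (ξ : H) : Measure A :=
  Measure.ofMeasurable (fun δ _ => ENNReal.ofReal (inner ℂ ξ (E δ ξ) : ℂ).re)
    (by simp [E.empty']) (fun δ hδ hd => by
      have h1 := Complex.hasSum_re ((E.iUnion' δ hδ hd ξ).mapL (innerSL ℂ ξ))
      simp only [innerSL_apply_apply] at h1
      rw [← h1.tsum_eq, ENNReal.ofReal_tsum_of_nonneg (fun n => ?_) h1.summable]
      exact (Complex.nonneg_iff.1 (E.inner_self_nonneg (δ n) ξ)).1)

theorem meas_apply (ξ : H) {δ : Set A} (hδ : MeasurableSet δ) :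
    E.meas ξ δ = ENNReal.ofReal (inner ℂ ξ (E δ ξ) : ℂ).re :=
  Measure.ofMeasurable_apply δ hδ

instance (ξ : H) : IsFiniteMeasure (E.meas ξ) :=
  ⟨by rw [meas_apply E ξ MeasurableSet.univ]; exact ENNReal.ofReal_lt_top⟩

theorem meas_real (ξ : H) {δ : Set A} (hδ : MeasurableSet δ) :
    ((E.meas ξ).real δ : ℂ) = inner ℂ ξ (E δ ξ) := by
  have h := Complex.nonneg_iff.1 (E.inner_self_nonneg δ ξ)
  rw [measureReal_def, meas_apply E ξ hδ, ENNReal.toReal_ofReal h.1]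
  exact Complex.ext rfl h.2

theorem meas_real_univ (ξ : H) : (E.meas ξ).real Set.univ = ‖ξ‖ ^ 2 := by
  have h := E.meas_real ξ MeasurableSet.univ
  rw [E.univ', one_apply_eq_self, inner_self_eq_norm_sq_to_K] at h
  exact Complex.ofReal_injective (h.trans (Complex.ofReal_pow _ _).symm)

section Complete

variable [CompleteSpace H]

/-- Setwise domination by positive measures passes to the variation. This yields integrability of
bounded functions and the norm bound on the integral. -/
theorem variation_coeff_le (ξ η : H) :
    (E.coeff ξ η).variation ≤ E.meas ξ + E.meas η := by
  refine VectorMeasure.variation_le_of_forall_enorm_le fun δ hδ => ?_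
  rw [Measure.add_apply, meas_apply E ξ hδ, meas_apply E η hδ, ← ENNReal.ofReal_add
    (Complex.nonneg_iff.1 (E.inner_self_nonneg δ ξ)).1
    (Complex.nonneg_iff.1 (E.inner_self_nonneg δ η)).1, ← ofReal_norm]
  exact ENNReal.ofReal_le_ofReal (IsPositive.norm_inner_le (E.isPositive δ) ξ η)

instance (ξ η : H) : IsFiniteMeasure (E.coeff ξ η).variation :=
  isFiniteMeasure_of_le _ (E.variation_coeff_le ξ η)

theorem variation_coeff_real_univ_le (ξ η : H) :
    (E.coeff ξ η).variation.real Set.univ ≤ ‖ξ‖ ^ 2 + ‖η‖ ^ 2 := by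
  rw [← E.meas_real_univ, ← E.meas_real_univ, ← measureReal_add_apply]
  exact ENNReal.toReal_mono (measure_ne_top _ _) (E.variation_coeff_le ξ η Set.univ)

/-- The integral of a function against `E_{ξ,η}`. -/
def coeffInt (ξ η : H) (f : A → ℂ) : ℂ :=
  (E.coeff ξ η).integral f (ContinuousLinearMap.mul ℝ ℂ)

variable {E} in
theorem integrable_of_bounded {ν : Measure A} [IsFiniteMeasure ν] {f : A → ℂ} (hf : Measurable f)
    (hb : ∃ C, ∀ a, ‖f a‖ ≤ C) : Integrable f ν := by
  obtain ⟨C, hC⟩ := hb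
  exact Integrable.of_bound hf.aestronglyMeasurable C (Eventually.of_forall hC)

theorem coeffInt_add (ξ η : H) {f g : A → ℂ} (hf : Measurable f) (hg : Measurable g)
    (hfb : ∃ C, ∀ a, ‖f a‖ ≤ C) (hgb : ∃ C, ∀ a, ‖g a‖ ≤ C) :
    E.coeffInt ξ η (f + g) = E.coeffInt ξ η f + E.coeffInt ξ η g :=
  VectorMeasure.integral_add (integrable_of_bounded hf hfb) (integrable_of_bounded hg hgb)

omit [CompleteSpace H] in
theorem coeffInt_smul (ξ η : H) (c : ℂ) (f : A → ℂ) :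
    E.coeffInt ξ η (c • f) = c * E.coeffInt ξ η f :=
  setToFun_smul _ (fun d _ x => mul_assoc d x _) c f

theorem coeffInt_indicator (ξ η : H) (c : ℂ) {s : Set A} (hs : MeasurableSet s) :
    E.coeffInt ξ η (s.indicator fun _ => c) = c * inner ℂ η (E s ξ) :=
  setToFun_indicator_const _ hs (measure_ne_top _ _) c

theorem norm_coeffInt_le (ξ η : H) {f : A → ℂ} {C : ℝ} (hC : 0 ≤ C) (hf : ∀ a, ‖f a‖ ≤ C) :
    ‖E.coeffInt ξ η f‖ ≤ C * (‖ξ‖ ^ 2 + ‖η‖ ^ 2) := by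
  refine (VectorMeasure.norm_integral_le_of_norm_le_const (Eventually.of_forall hf)).trans ?_
  have h1 := ContinuousLinearMap.opNorm_mul_le ℝ ℂ
  have h2 := E.variation_coeff_real_univ_le ξ η
  have h3 : C * ‖ContinuousLinearMap.mul ℝ ℂ‖ ≤ C * 1 := by gcongr
  rw [mul_one] at h3
  gcongr

theorem tendsto_coeffInt (ξ η : H) {F : ℕ → A → ℂ} {f : A → ℂ} {C : ℝ}
    (hF : ∀ n, Measurable (F n)) (hC : ∀ n a, ‖F n a‖ ≤ C)
    (hlim : ∀ a, Tendsto (fun n => F n a) atTop (𝓝 (f a))) :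
    Tendsto (fun n => E.coeffInt ξ η (F n)) atTop (𝓝 (E.coeffInt ξ η f)) :=
  VectorMeasure.tendsto_integral_of_dominated_convergence (fun _ => C)
    (fun n => (hF n).aestronglyMeasurable) (integrable_const C)
    (fun n => Eventually.of_forall (hC n)) (Eventually.of_forall hlim)

theorem coeffInt_self (ξ : H) {f : A → ℂ} (hf : Measurable f) (hb : ∃ C, ∀ a, ‖f a‖ ≤ C) :
    E.coeffInt ξ ξ f = ∫ a, f a ∂E.meas ξ := by
  refine bounded_measurable_induction (P := fun f => E.coeffInt ξ ξ f = ∫ a, f a ∂E.meas ξ) ?_ ?_ ?_ f hf hb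
  · intro c s hs
    rw [coeffInt_indicator E ξ ξ c hs, integral_indicator_const c hs, ← meas_real E ξ hs, mul_comm]
    rfl
  · intro f g hf hg hfb hgb h1 h2
    rw [coeffInt_add E ξ ξ hf hg hfb hgb, h1, h2]
    exact (integral_add (integrable_of_bounded hf hfb) (integrable_of_bounded hg hgb)).symm
  · intro F f C hF hC hlim h
    refine tendsto_nhds_unique (tendsto_coeffInt E ξ ξ hF hC hlim) ?_
    simp only [h]
    exact tendsto_integral_of_dominated_convergence (fun _ => C)
      (fun n => (hF n).aestronglyMeasurable) (integrable_const C)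
      (fun n => Eventually.of_forall (hC n)) (Eventually.of_forall hlim)

/-- Sesquilinearity of the integral in `(ξ, η)` need not be proved separately: indicators are
represented by multiples of `E s`, and dominated convergence turns bounded pointwise limits into
weak limits of operators. -/
theorem exists_intOp {f : A → ℂ} (hf : Measurable f) (hb : ∃ C, ∀ a, ‖f a‖ ≤ C) :
    ∃ T : H →L[ℂ] H, ∀ ξ η, inner ℂ η (T ξ) = E.coeffInt ξ η f := by
  refine bounded_measurable_induction (P := fun f =>
    ∃ T : H →L[ℂ] H, ∀ ξ η, inner ℂ η (T ξ) = E.coeffInt ξ η f) ?_ ?_ ?_ f hf hb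
  · intro c s hs
    refine ⟨c • E s, fun ξ η => ?_⟩
    rw [coeffInt_indicator E ξ η c hs]
    exact inner_smul_right _ _ _
  · intro f g hf hg hfb hgb h1 h2
    obtain ⟨S, hS⟩ := h1
    obtain ⟨T, hT⟩ := h2
    refine ⟨S + T, fun ξ η => ?_⟩
    rw [coeffInt_add E ξ η hf hg hfb hgb, ← hS, ← hT]
    exact inner_add_right _ _ _
  · intro F f C hF hC hlim h
    choose T hT using h
    refine exists_clm_of_tendsto_inner T _ fun ξ η => ?_
    simp only [hT]
    exact tendsto_coeffInt E ξ η hF hC hlim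

open Classical in
/-- The operator `∫ f dE`, for a bounded measurable function `f`. -/
def intOp (f : A → ℂ) : H →L[ℂ] H :=
  if h : ∃ T : H →L[ℂ] H, ∀ ξ η, inner ℂ η (T ξ) = E.coeffInt ξ η f then h.choose else 0

theorem inner_intOp {f : A → ℂ} (hf : Measurable f) (hb : ∃ C, ∀ a, ‖f a‖ ≤ C) (ξ η : H) :
    inner ℂ η (E.intOp f ξ) = E.coeffInt ξ η f := by
  have h := E.exists_intOp hf hb
  rw [intOp, dif_pos h]
  exact h.choose_spec ξ η

end Complete

section Continuous

variable [CompleteSpace H] [TopologicalSpace A] [CompactSpace A] [BorelSpace A]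

omit [MeasurableSpace A] [BorelSpace A] in
theorem continuousMap_bounded (f : C(A, ℂ)) : ∃ C, ∀ a, ‖f a‖ ≤ C := ⟨‖f‖, f.norm_coe_le_norm⟩

theorem inner_intOp_continuousMap (f : C(A, ℂ)) (ξ η : H) :
    inner ℂ η (E.intOp f ξ) = E.coeffInt ξ η f :=
  E.inner_intOp f.continuous.measurable (continuousMap_bounded f) ξ η

theorem intOp_add (f g : C(A, ℂ)) : E.intOp ⇑(f + g) = E.intOp f + E.intOp g := by
  refine ContinuousLinearMap.ext fun ξ => ext_inner_left ℂ fun η => ?_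
  rw [add_apply, inner_add_right, inner_intOp_continuousMap,
    inner_intOp_continuousMap, inner_intOp_continuousMap]
  exact E.coeffInt_add ξ η f.continuous.measurable g.continuous.measurable
    (continuousMap_bounded f) (continuousMap_bounded g)

theorem intOp_smul (c : ℂ) (f : C(A, ℂ)) : E.intOp ⇑(c • f) = c • E.intOp f := by
  refine ContinuousLinearMap.ext fun ξ => ext_inner_left ℂ fun η => ?_
  rw [smul_apply, inner_smul_right, inner_intOp_continuousMap,
    inner_intOp_continuousMap]
  exact E.coeffInt_smul ξ η c f

theorem intOp_one : E.intOp ⇑(1 : C(A, ℂ)) = 1 := by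
  refine ContinuousLinearMap.ext fun ξ => ext_inner_left ℂ fun η => ?_
  rw [inner_intOp_continuousMap]
  have h := E.coeffInt_indicator ξ η 1 MeasurableSet.univ
  rw [Set.indicator_univ, E.univ', one_mul] at h
  exact h

theorem norm_intOp_le (f : C(A, ℂ)) : ‖E.intOp f‖ ≤ 2 * ‖f‖ :=
  opNorm_le_of_norm_inner_le (norm_nonneg f) fun ξ η => by
    rw [inner_intOp_continuousMap]
    exact E.norm_coeffInt_le ξ η (norm_nonneg f) f.norm_coe_le_norm

theorem inner_self_intOp (f : C(A, ℂ)) (ξ : H) :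
    inner ℂ ξ (E.intOp f ξ) = ∫ a, f a ∂E.meas ξ := by
  rw [inner_intOp_continuousMap]
  exact E.coeffInt_self ξ f.continuous.measurable (continuousMap_bounded f)

theorem isPositive_intOp {f : C(A, ℂ)} (hf : 0 ≤ f) : (E.intOp f).IsPositive := by
  refine clm_isPositive_iff_inner.2 fun ξ => ?_
  rw [inner_self_intOp]
  exact integral_nonneg_of_ae (Eventually.of_forall fun a => hf a)

/-- `f ↦ ∫ f dE` as a bounded linear map on `C(A)`. -/
def intCLM : C(A, ℂ) →L[ℂ] H →L[ℂ] H :=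
  LinearMap.mkContinuous
    { toFun := fun f => E.intOp f
      map_add' := E.intOp_add
      map_smul' := E.intOp_smul } 2 E.norm_intOp_le

theorem intCLM_apply (f : C(A, ℂ)) : E.intCLM f = E.intOp f := rfl

/-- Integrals of continuous functions determine the finite measures `E_{ξ,ξ}`, and these determine
the operators by polarization. -/
theorem ext_of_intCLM [HasOuterApproxClosed A] {E F : QuantumMeasure A H}
    (h : E.intCLM = F.intCLM) : E = F := by
  refine ext fun δ hδ => clm_ext_inner_self fun ξ => ?_
  have hm : E.meas ξ = F.meas ξ := by
    refine ext_of_forall_integral_eq_of_IsFiniteMeasure fun f => ?_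
    let g : C(A, ℂ) := ⟨fun a => (f a : ℂ), by fun_prop⟩
    have h1 := E.inner_self_intOp g ξ
    have h2 := F.inner_self_intOp g ξ
    rw [← intCLM_apply, h, intCLM_apply, h2] at h1
    have h3 : ∀ ν : Measure A, ∫ a, g a ∂ν = ((∫ a, f a ∂ν : ℝ) : ℂ) := fun ν => integral_ofReal
    rw [h3, h3] at h1
    exact_mod_cast h1.symm
  rw [← meas_real E ξ hδ, ← meas_real F ξ hδ, hm]

end Continuous

end QuantumMeasure

/-! ### Riesz representation of unital positive maps `C(A) → B(H)`. -/

section Representation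

variable {A : Type*} [TopologicalSpace A] [CompactSpace A] [T2Space A]
  [MeasurableSpace A] [BorelSpace A]
  {H : Type*} [NormedAddCommGroup H] [InnerProductSpace ℂ H]

/-- A real continuous function, seen as a complex one. -/
def complexify (f : C(A, ℝ)) : C(A, ℂ) := ⟨fun a => (f a : ℂ), by fun_prop⟩

/-- The Riesz measure of a positive functional `f ↦ ⟨ξ, φ(f) ξ⟩`. -/
theorem exists_measure_of_positive (φ : C(A, ℂ) →L[ℂ] H →L[ℂ] H)
    (hpos : ∀ f, 0 ≤ f → (φ f).IsPositive) (ξ : H) :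
    ∃ m : Measure A, IsFiniteMeasure m ∧
      ∀ f : C(A, ℝ), ∫ a, f a ∂m = (inner ℂ ξ (φ (complexify f) ξ) : ℂ).re := by
  -- On a compact space every continuous function has compact support, so Riesz–Markov applies to
  -- all of `C(A, ℝ)`.
  let Λ : CompactlySupportedContinuousMap A ℝ →ₚ[ℝ] ℝ := PositiveLinearMap.mk₀
    { toFun := fun f => (inner ℂ ξ (φ (complexify f.toContinuousMap) ξ) : ℂ).re
      map_add' := fun f g => by
        have : complexify (f + g).toContinuousMap
            = complexify f.toContinuousMap + complexify g.toContinuousMap := by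
          ext a; simp [complexify]
        rw [this, map_add, add_apply, inner_add_right, Complex.add_re]
      map_smul' := fun c f => by
        have : complexify (c • f).toContinuousMap
            = (c : ℂ) • complexify f.toContinuousMap := by
          ext a; simp [complexify]
        rw [this, map_smul, smul_apply, inner_smul_right, Complex.re_ofReal_mul]
        rfl }
    (fun f hf => by
      refine (Complex.nonneg_iff.1 ((hpos _ fun a => ?_).inner_nonneg_right ξ)).1
      exact Complex.zero_le_real.2 (hf a))
  refine ⟨RealRMK.rieszMeasure Λ, ?_, fun f => ?_⟩
  · infer_instance
  · exact RealRMK.integral_rieszMeasure Λ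
      ⟨f, HasCompactSupport.of_compactSpace f⟩

-- The sequence approximates the indicator of `F` pointwise and does not depend on `m`. Hence the
-- same functions serve all `ξ`, and later all `x`, at once.
omit [CompactSpace A] [T2Space A] in
theorem exists_seq_tendsto_measureReal [HasOuterApproxClosed A] {F : Set A} (hF : IsClosed F) :
    ∃ f : ℕ → C(A, ℝ), ∀ m : Measure A, IsFiniteMeasure m →
      Tendsto (fun n => ∫ a, f n a ∂m) atTop (𝓝 (m.real F)) := by
  refine ⟨fun n => ⟨fun a => (hF.apprSeq n a : ℝ), by fun_prop⟩, fun m hm => ?_⟩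
  rw [← integral_indicator_one hF.measurableSet]
  refine tendsto_integral_of_dominated_convergence (fun _ => 1)
    (fun n => (by fun_prop : Continuous fun a => (hF.apprSeq n a : ℝ)).aestronglyMeasurable)
    (integrable_const 1) (fun n => Eventually.of_forall fun a => ?_)
    (Eventually.of_forall fun a => ?_)
  · change ‖((hF.apprSeq n a : NNReal) : ℝ)‖ ≤ 1
    rw [Real.norm_of_nonneg (NNReal.coe_nonneg _)]
    exact_mod_cast HasOuterApproxClosed.apprSeq_apply_le_one hF n a
  · have h := (NNReal.continuous_coe.tendsto _).comp
      ((tendsto_pi_nhds.1 (HasOuterApproxClosed.tendsto_apprSeq hF)) a)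
    have h2 : F.indicator (1 : A → ℝ) a = ((F.indicator (fun _ => 1) a : NNReal) : ℝ) := by
      by_cases ha : a ∈ F <;> simp [ha]
    rw [h2]
    exact h

omit [TopologicalSpace A] [CompactSpace A] [T2Space A] [BorelSpace A] in
theorem hasSum_measureReal_iUnion {m : Measure A} [IsFiniteMeasure m] {δ : ℕ → Set A}
    (hδ : ∀ n, MeasurableSet (δ n)) (hd : Pairwise (Function.onFun Disjoint δ)) :
    HasSum (fun n => m.real (δ n)) (m.real (⋃ n, δ n)) := by
  have h := measure_iUnion hd hδ (μ := m)
  rw [measureReal_def, h, ENNReal.tsum_toReal_eq fun n => measure_ne_top m _]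
  exact ENNReal.hasSum_toReal (h ▸ measure_ne_top m _)

variable [CompleteSpace H]

omit [CompactSpace A] [T2Space A] in
/-- If the Riesz measures are given by quadratic forms on continuous functions, then they are
given by quadratic forms on Borel sets. -/
theorem exists_clm_of_measures [HasOuterApproxClosed A] {m : H → Measure A}
    [∀ ξ, IsFiniteMeasure (m ξ)] {φ : C(A, ℂ) →L[ℂ] H →L[ℂ] H} (h1 : φ 1 = 1)
    (hm : ∀ ξ (f : C(A, ℝ)), ((∫ a, f a ∂m ξ : ℝ) : ℂ) = inner ℂ ξ (φ (complexify f) ξ))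
    (δ : Set A) (hδ : MeasurableSet δ) :
    ∃ T : H →L[ℂ] H, ∀ ξ, inner ℂ ξ (T ξ) = ((m ξ).real δ : ℂ) := by
  induction δ, hδ using MeasurableSpace.induction_on_inter
    ((BorelSpace.measurable_eq (α := A)).trans borel_eq_generateFrom_isClosed)
    isPiSystem_isClosed with
  | empty => exact ⟨0, fun ξ => by simp⟩
  | basic F hF =>
    obtain ⟨f, hf⟩ := exists_seq_tendsto_measureReal hF
    refine exists_clm_of_tendsto_inner_self (fun n => φ (complexify (f n))) _ fun ξ => ?_
    simp only [← hm]
    exact (Complex.continuous_ofReal.tendsto _).comp (hf (m ξ) inferInstance)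
  | compl δ hδ h =>
    obtain ⟨T, hT⟩ := h
    refine ⟨1 - T, fun ξ => ?_⟩
    have h2 := hm ξ 1
    have h3 : complexify (1 : C(A, ℝ)) = 1 := by ext a; simp [complexify]
    rw [h3, h1] at h2
    simp only [ContinuousMap.one_apply, integral_const, smul_eq_mul, mul_one] at h2
    rw [sub_apply, inner_sub_right, hT, ← h2, measureReal_compl hδ]
    push_cast
    rfl
  | iUnion δ hd hδ h =>
    choose T hT using h
    refine exists_clm_of_tendsto_inner_self (fun n => ∑ i ∈ Finset.range n, T i) _ fun ξ => ?_
    have h2 := (Complex.hasSum_ofReal.2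
      (hasSum_measureReal_iUnion (m := m ξ) hδ hd)).tendsto_sum_nat
    refine h2.congr fun n => ?_
    rw [sum_apply, inner_sum]
    exact Finset.sum_congr rfl fun i _ => (hT i ξ).symm

omit [TopologicalSpace A] [CompactSpace A] [T2Space A] [BorelSpace A] in
/-- A positive operator-valued set function whose quadratic forms are measures is countably
additive in the strong operator topology. -/
theorem hasSum_of_measures {m : H → Measure A}
    [∀ ξ, IsFiniteMeasure (m ξ)] {E : Set A → H →L[ℂ] H}
    (hE : ∀ δ, MeasurableSet δ → ∀ ξ, inner ℂ ξ (E δ ξ) = ((m ξ).real δ : ℂ))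
    (huniv : E Set.univ = 1)
    {δ : ℕ → Set A} (hδ : ∀ n, MeasurableSet (δ n)) (hd : Pairwise (Function.onFun Disjoint δ))
    (ξ : H) : HasSum (fun n => E (δ n) ξ) (E (⋃ n, δ n) ξ) := by
  have hle : ∀ s ζ, (m ζ).real s ≤ ‖ζ‖ ^ 2 := fun s ζ => by
    have h := hE _ MeasurableSet.univ ζ
    rw [huniv, one_apply_eq_self, inner_self_eq_norm_sq_to_K] at h
    have h2 : (m ζ).real Set.univ = ‖ζ‖ ^ 2 :=
      Complex.ofReal_injective (h.symm.trans (Complex.ofReal_pow _ _).symm)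
    rw [← h2]
    exact measureReal_mono (Set.subset_univ s)
  -- The quadratic form of the remainder is the tail of a convergent series of measures. The
  -- remainder thus lies between `0` and `1`, and `IsPositive.norm_apply_sq_le` bounds its strong
  -- size by that tail.
  have hkey : ∀ s : Finset ℕ, ∀ ζ, inner ℂ ζ ((E (⋃ n, δ n) - ∑ n ∈ s, E (δ n)) ζ)
      = (((m ζ).real (⋃ n, δ n) - ∑ n ∈ s, (m ζ).real (δ n) : ℝ) : ℂ) := fun s ζ => by
    rw [sub_apply, sum_apply, inner_sub_right, inner_sum,
      hE _ (MeasurableSet.iUnion hδ)]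
    push_cast
    congr 1
    exact Finset.sum_congr rfl fun i _ => hE _ (hδ i) ζ
  have hsum := fun ζ => hasSum_measureReal_iUnion (m := m ζ) hδ hd
  have hpos : ∀ (s : Finset ℕ) ζ, 0 ≤ (m ζ).real (⋃ n, δ n) - ∑ n ∈ s, (m ζ).real (δ n) :=
    fun s ζ => sub_nonneg.2 (sum_le_hasSum s (fun _ _ => measureReal_nonneg) (hsum ζ))
  have hbound : ∀ s : Finset ℕ, ‖(∑ n ∈ s, E (δ n) ξ) - E (⋃ n, δ n) ξ‖ ^ 2
      ≤ (m ξ).real (⋃ n, δ n) - ∑ n ∈ s, (m ξ).real (δ n) := fun s => by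
    have h := IsPositive.norm_apply_sq_le (T := E (⋃ n, δ n) - ∑ n ∈ s, E (δ n))
      (clm_isPositive_iff_inner.2 fun ζ => by
        rw [hkey]; exact Complex.zero_le_real.2 (hpos s ζ))
      (fun ζ => by
        rw [hkey, Complex.ofReal_re]
        refine (sub_le_self _ (Finset.sum_nonneg fun _ _ => measureReal_nonneg)).trans (hle _ ζ)) ξ
    rw [hkey, Complex.ofReal_re, sub_apply, sum_apply] at h
    rwa [norm_sub_rev]
  have h0 : Tendsto (fun s : Finset ℕ => (m ξ).real (⋃ n, δ n) - ∑ n ∈ s, (m ξ).real (δ n))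
      atTop (𝓝 0) := by
    have := (tendsto_const_nhds (x := (m ξ).real (⋃ n, δ n))).sub (hsum ξ)
    rwa [sub_self] at this
  refine tendsto_iff_norm_sub_tendsto_zero.2 ?_
  have h3 := squeeze_zero (fun _ => sq_nonneg _) hbound h0
  have h4 := (Real.continuous_sqrt.tendsto 0).comp h3
  rw [Real.sqrt_zero] at h4
  exact h4.congr fun s => Real.sqrt_sq (norm_nonneg _)

/-- Every unital positive map `C(A) → B(H)` is integration against a quantum probability
measure. -/
theorem exists_quantumMeasure [HasOuterApproxClosed A] (φ : C(A, ℂ) →L[ℂ] H →L[ℂ] H)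
    (h1 : φ 1 = 1) (hpos : ∀ f, 0 ≤ f → (φ f).IsPositive) :
    ∃ E : QuantumMeasure A H, E.intCLM = φ := by
  choose m hfin hm using exists_measure_of_positive φ hpos
  have hreal : ∀ f : C(A, ℝ), ∀ ξ,
      (inner ℂ ξ (φ (complexify f) ξ) : ℂ).im = 0 := fun f ξ => by
    -- A real function is a nonnegative one minus a constant. Both have real quadratic forms under
    -- `φ`, by positivity and unitality.
    have h2 : complexify f = complexify (f + ‖f‖ • 1) - (‖f‖ : ℂ) • 1 := by
      ext a; simp [complexify]
    have h3 : 0 ≤ complexify (f + ‖f‖ • 1) := fun a => by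
      refine Complex.zero_le_real.2 ?_
      have := (abs_le.1 (f.norm_coe_le_norm a)).1
      simp
      linarith
    rw [h2, map_sub, map_smul, h1, sub_apply, smul_apply, one_apply_eq_self, inner_sub_right,
      Complex.sub_im, inner_smul_right, inner_self_eq_norm_sq_to_K,
      ← (Complex.nonneg_iff.1 ((hpos _ h3).inner_nonneg_right ξ)).2]
    simp [← Complex.ofReal_pow]
  have hm' : ∀ ξ (f : C(A, ℝ)),
      ((∫ a, f a ∂m ξ : ℝ) : ℂ) = inner ℂ ξ (φ (complexify f) ξ) := fun ξ f =>
    Complex.ext (hm ξ f) (hreal f ξ).symm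
  choose T hT using exists_clm_of_measures h1 hm'
  classical
  let E : Set A → H →L[ℂ] H := fun δ => if h : MeasurableSet δ then T δ h else 0
  have hE : ∀ δ, MeasurableSet δ → ∀ ξ, inner ℂ ξ (E δ ξ) = ((m ξ).real δ : ℂ) :=
    fun δ hδ ξ => by
      simp only [E, dif_pos hδ]
      exact hT δ hδ ξ
  have huniv : E Set.univ = 1 := by
    refine clm_ext_inner_self fun ξ => ?_
    have h2 := hm' ξ 1
    have h3 : complexify (1 : C(A, ℝ)) = 1 := by ext a; simp [complexify]
    rw [h3, h1] at h2
    simp only [ContinuousMap.one_apply, integral_const, smul_eq_mul, mul_one] at h2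
    rw [hE _ MeasurableSet.univ, h2]
  let Q : QuantumMeasure A H :=
    { toFun := E
      not_measurable' := fun δ hδ => dif_neg hδ
      isPositive' := fun δ hδ => clm_isPositive_iff_inner.2 fun ξ => by
        rw [hE δ hδ]; exact Complex.zero_le_real.2 measureReal_nonneg
      empty' := clm_ext_inner_self fun ξ => by
        rw [hE _ MeasurableSet.empty]; simp
      univ' := huniv
      iUnion' := fun δ hδ hd ξ => hasSum_of_measures hE huniv hδ hd ξ }
  refine ⟨Q, ?_⟩
  have hQm : ∀ ξ, Q.meas ξ = m ξ := fun ξ => by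
    refine Measure.ext fun δ hδ => ?_
    have := (Q.meas_real ξ hδ).trans (hE δ hδ ξ)
    exact (measureReal_eq_measureReal_iff (measure_ne_top _ _) (measure_ne_top _ _)).1
      (Complex.ofReal_injective this)
  have hre : ∀ f : C(A, ℝ), Q.intCLM (complexify f) = φ (complexify f) := fun f => by
    refine clm_ext_inner_self fun ξ => ?_
    rw [QuantumMeasure.intCLM_apply, QuantumMeasure.inner_self_intOp, hQm, ← hm']
    exact integral_ofReal
  refine ContinuousLinearMap.ext fun f => ?_
  have hf : f = complexify ⟨fun a => (f a).re, by fun_prop⟩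
      + Complex.I • complexify ⟨fun a => (f a).im, by fun_prop⟩ := by
    ext a
    simp [complexify, mul_comm Complex.I]
  rw [hf, map_add, map_add, map_smul, map_smul, hre, hre]

end Representation
-- Positive maps on `C(A)` are completely positive.
section CompletePositivity

/-- With `b = star d * d`, the matrix is `star R * R`, where the only nonzero row of `R` is row `0`,
with entries `c i • d`. Empty matrices have no such row and are treated apart. -/
theorem rankOne_nonneg {B : Type*} [CStarAlgebra B] [PartialOrder B] [StarOrderedRing B]
    {k : ℕ} (c : Fin k → ℂ) {b : B} (hb : 0 ≤ b) :
    0 ≤ CStarMatrix.ofMatrix (fun i j => (star (c i) * c j) • b : Matrix (Fin k) (Fin k) B) := by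
  obtain ⟨d, rfl⟩ := CStarAlgebra.nonneg_iff_eq_star_mul_self.1 hb
  cases k with
  | zero => exact le_of_eq (CStarMatrix.ext fun i => i.elim0)
  | succ k =>
    let R : CStarMatrix (Fin (k + 1)) (Fin (k + 1)) B :=
      CStarMatrix.ofMatrix fun l i => if l = 0 then c i • d else 0
    have hR : ∀ l i, R l i = if l = 0 then c i • d else 0 := fun _ _ => rfl
    have h : CStarMatrix.ofMatrix (fun i j => (star (c i) * c j) • (star d * d) :
        Matrix (Fin (k + 1)) (Fin (k + 1)) B) = star R * R := by
      ext i j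
      rw [CStarMatrix.mul_apply, Finset.sum_eq_single 0]
      · rw [CStarMatrix.star_apply, hR, hR, if_pos rfl, if_pos rfl, star_smul, smul_mul_smul_comm]
        rfl
      · intro l _ hl
        rw [hR, if_neg hl, mul_zero]
      · exact fun h => absurd (Finset.mem_univ _) h
    rw [h]
    exact star_mul_self_nonneg R

variable {A : Type*} [TopologicalSpace A] [CompactSpace A] [T2Space A]

/-- A finite family of continuous functions is uniformly approximated by sampling along a finite
partition of unity. -/
theorem exists_partition_approx {ι : Type*} [Fintype ι] (u : ι → C(A, ℂ)) {ε : ℝ} (hε : 0 < ε) :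
    ∃ (t : Finset A) (h : A → C(A, ℂ)), (∀ p, 0 ≤ h p) ∧
      ∀ i, ‖∑ p ∈ t, u i p • h p - u i‖ ≤ ε := by
  -- Bundling the family into one map to `ι → ℂ` with the sup metric yields a single cover, hence
  -- one partition of unity good for all `i`.
  let G : A → ι → ℂ := fun a i => u i a
  have hG : Continuous G := continuous_pi fun i => (u i).continuous
  let U : A → Set A := fun p => {a | dist (G a) (G p) < ε}
  have hUo : ∀ p, IsOpen (U p) := fun p => isOpen_lt (hG.dist continuous_const) continuous_const
  obtain ⟨t, ht⟩ := isCompact_univ.elim_finite_subcover U hUo fun a _ =>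
    Set.mem_iUnion.2 ⟨a, by simpa [U] using hε⟩
  have hcov : (Set.univ : Set A) ⊆ ⋃ p : t, U p := fun a ha => by
    obtain ⟨p, hp, hap⟩ := Set.mem_iUnion₂.1 (ht ha)
    exact Set.mem_iUnion.2 ⟨⟨p, hp⟩, hap⟩
  obtain ⟨ρ, hρ⟩ := PartitionOfUnity.exists_isSubordinate isClosed_univ (fun p : t => U p)
    (fun p => hUo p) hcov
  classical
  let h : A → C(A, ℂ) := fun p => if hp : p ∈ t then complexify (ρ ⟨p, hp⟩) else 0
  refine ⟨t, h, fun p => ?_, fun i => ?_⟩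
  · by_cases hp : p ∈ t
    · simp only [h, dif_pos hp]
      exact fun a => Complex.zero_le_real.2 (ρ.nonneg _ a)
    · simp only [h, dif_neg hp]
      exact le_rfl
  · refine (ContinuousMap.norm_le _ hε.le).2 fun a => ?_
    have hsum : ∑ p : t, (ρ p a : ℂ) = 1 := by
      have := ρ.sum_eq_one (Set.mem_univ a)
      rw [finsum_eq_sum_of_fintype] at this
      exact_mod_cast this
    have hval : (∑ p ∈ t, u i p • h p - u i) a
        = ∑ p : t, (ρ p a : ℂ) * (u i p - u i a) := by
      simp only [mul_sub, Finset.sum_sub_distrib, ← Finset.sum_mul, hsum, one_mul]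
      rw [ContinuousMap.sub_apply, ContinuousMap.sum_apply, ← Finset.sum_coe_sort]
      congr 1
      refine Finset.sum_congr rfl fun p _ => ?_
      simp [h, complexify, mul_comm]
    rw [hval]
    calc ‖∑ p : t, (ρ p a : ℂ) * (u i p - u i a)‖
        ≤ ∑ p : t, ρ p a * ε := by
          refine norm_sum_le_of_le _ fun p _ => ?_
          rw [norm_mul, Complex.norm_real, Real.norm_of_nonneg (ρ.nonneg p a)]
          by_cases h0 : ρ p a = 0
          · simp [h0]
          · have hmem : a ∈ U p := hρ p (subset_tsupport _ h0)
            gcongr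
            · exact ρ.nonneg p a
            · rw [norm_sub_rev, ← dist_eq_norm]
              exact (dist_le_pi_dist (G a) (G p) i).trans hmem.le
      _ = ε := by
          rw [← Finset.sum_mul]
          have : ∑ p : t, ρ p a = 1 := by exact_mod_cast hsum
          rw [this, one_mul]

variable {B : Type*} [CStarAlgebra B] [PartialOrder B] [StarOrderedRing B]

/-- All entries are sampled along the same partition, so each approximant is a sum of matrices
`(star (g i p) * g j p) • φ (h p)`, positive by `rankOne_nonneg`. The positive cone is closed and
convergence is entrywise. -/
theorem gram_nonneg (φ : C(A, ℂ) →L[ℂ] B) (hpos : ∀ f, 0 ≤ f → 0 ≤ φ f) {k : ℕ}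
    (g : Fin k → C(A, ℂ)) :
    0 ≤ CStarMatrix.ofMatrix (fun i j => φ (star (g i) * g j) : Matrix (Fin k) (Fin k) B) := by
  let u : Fin k × Fin k → C(A, ℂ) := fun q => star (g q.1) * g q.2
  choose t h hh hu using fun n : ℕ => exists_partition_approx u (Nat.one_div_pos_of_nat (n := n)
    (α := ℝ))
  have hlim : ∀ q, Tendsto (fun n => φ (∑ p ∈ t n, u q p • h n p)) atTop (𝓝 (φ (u q))) :=
    fun q => (φ.continuous.tendsto _).comp (tendsto_iff_norm_sub_tendsto_zero.2
      (squeeze_zero (fun _ => norm_nonneg _) (fun n => hu n q)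
        tendsto_one_div_add_atTop_nhds_zero_nat))
  have hmat : Tendsto (fun n => (CStarMatrix.ofMatrix
      (fun i j => φ (∑ p ∈ t n, u (i, j) p • h n p)) : CStarMatrix (Fin k) (Fin k) B)) atTop
      (𝓝 (CStarMatrix.ofMatrix (fun i j => φ (star (g i) * g j)))) :=
    tendsto_pi_nhds.2 fun i => tendsto_pi_nhds.2 fun j => hlim (i, j)
  refine CStarAlgebra.isClosed_nonneg.mem_of_tendsto hmat (Eventually.of_forall fun n => ?_)
  have : (CStarMatrix.ofMatrix (fun i j => φ (∑ p ∈ t n, u (i, j) p • h n p)) :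
      CStarMatrix (Fin k) (Fin k) B) = ∑ p ∈ t n, CStarMatrix.ofMatrix
        (fun i j => (star (g i p) * g j p) • φ (h n p)) := by
    ext i j
    have hs : ∀ (s : Finset A) (N : A → CStarMatrix (Fin k) (Fin k) B),
        (∑ p ∈ s, N p) i j = ∑ p ∈ s, N p i j := fun s N => Matrix.sum_apply i j s N
    rw [hs]
    change φ (∑ p ∈ t n, u (i, j) p • h n p) = _
    rw [map_sum]
    exact Finset.sum_congr rfl fun p _ => map_smul _ _ _
  rw [Set.mem_ofPred_eq]
  rw [this]
  exact Finset.sum_nonneg fun p _ => rankOne_nonneg (fun i => g i p) (hpos _ (hh n p))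

/-- A positive map on a commutative C⋆-algebra is completely positive. -/
theorem map_cstarMatrix_nonneg_of_positive (φ : C(A, ℂ) →L[ℂ] B)
    (hpos : ∀ f, 0 ≤ f → 0 ≤ φ f) (k : ℕ) (M : CStarMatrix (Fin k) (Fin k) C(A, ℂ))
    (hM : 0 ≤ M) : 0 ≤ M.map φ := by
  rw [StarOrderedRing.nonneg_iff] at hM
  induction hM using AddSubmonoid.closure_induction with
  | zero => exact le_of_eq (CStarMatrix.ext fun i j => (map_zero φ).symm)
  | add M N _ _ hM hN =>
    have : (M + N).map φ = M.map φ + N.map φ := CStarMatrix.ext fun i j => map_add φ _ _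
    rw [this]
    exact add_nonneg hM hN
  | mem M hM =>
    obtain ⟨G, rfl⟩ := hM
    -- Each row of `G` contributes one Gram matrix.
    have : (star G * G).map φ = ∑ l, CStarMatrix.ofMatrix
        (fun i j => φ (star (G l i) * G l j) : Matrix (Fin k) (Fin k) B) := by
      ext i j
      have hs : ∀ (N : Fin k → CStarMatrix (Fin k) (Fin k) B),
          (∑ p, N p) i j = ∑ p, N p i j := fun N => Matrix.sum_apply i j _ N
      rw [hs, CStarMatrix.map_apply, CStarMatrix.mul_apply, map_sum]
      rfl
    change 0 ≤ (star G * G).map φ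
    rw [this]
    exact Finset.sum_nonneg fun l _ => gram_nonneg φ hpos (G l)

end CompletePositivity

/-! ### Positivity and equality in `L^∞_σ` from pointwise data. -/

section Positivity

variable {X : Type*} [MeasurableSpace X] {μ : Measure X}
  {H : Type*} [NormedAddCommGroup H] [InnerProductSpace ℂ H] [CompleteSpace H]
  [TopologicalSpace.SeparableSpace H]

/-- For self-adjoint `a` with `‖a‖ ≤ t`, the bound `‖t - a‖ ≤ t` says that the spectrum is
nonnegative. Expressed by norms, positivity can be compared with the essential supremum. -/
theorem nonneg_iff_isSelfAdjoint_and_norm_le {B : Type*} [CStarAlgebra B] [PartialOrder B]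
    [StarOrderedRing B] {a : B} {t : NNReal} (ht : ‖a‖₊ ≤ t) :
    0 ≤ a ↔ IsSelfAdjoint a ∧ ‖algebraMap ℝ B t - a‖₊ ≤ t := by
  rw [nonneg_iff_isSelfAdjoint_and_quasispectrumRestricts]
  refine and_congr_right fun ha => ?_
  rw [quasispectrumRestricts_iff_spectrumRestricts,
    SpectrumRestricts.nnreal_iff_nnnorm ha ht]

theorem LinftySigma.mk_nonneg {g : EssBdd H μ}
    (hg : ∀ᵐ x ∂μ, ((g : X → H →L[ℂ] H) x).IsPositive) : 0 ≤ LinftySigma.mk g := by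
  have hsa : IsSelfAdjoint (LinftySigma.mk g) := by
    rw [IsSelfAdjoint, ← LinftySigma.mk_star, LinftySigma.mk_eq_mk]
    filter_upwards [hg] with x hx using hx.isSelfAdjoint
  refine (nonneg_iff_isSelfAdjoint_and_norm_le (t := ‖LinftySigma.mk g‖₊) le_rfl).2 ⟨hsa, ?_⟩
  set t := ‖LinftySigma.mk g‖₊ with ht
  have h1 : algebraMap ℝ (LinftySigma H μ) t - LinftySigma.mk g
      = LinftySigma.mk (((t : ℝ) : ℂ) • 1 - g) := by
    rw [LinftySigma.mk_sub, LinftySigma.mk_smul, LinftySigma.mk_one,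
      Algebra.algebraMap_eq_smul_one, Complex.coe_smul]
  rw [h1, ← NNReal.coe_le_coe]
  refine (LinftySigma.norm_mk_le_iff t.2).2 ?_
  filter_upwards [hg, LinftySigma.ae_norm_le g] with x hx hx2
  have h2 := ((nonneg_iff_isSelfAdjoint_and_norm_le (a := (g : X → H →L[ℂ] H) x) (t := t) hx2).1
    ((ContinuousLinearMap.nonneg_iff_isPositive _).2 hx)).2
  rw [Algebra.algebraMap_eq_smul_one] at h2
  rw [← Complex.coe_smul] at h2
  exact h2

-- Separability lets one null set serve a countable dense set of pairs `(ξ, η)`; continuity of the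
-- operators does the rest.
omit [CompleteSpace H] in
theorem ae_eq_of_forall_inner {u v : X → H →L[ℂ] H}
    (h : ∀ ξ η, ∀ᵐ x ∂μ, inner ℂ η (u x ξ) = inner ℂ η (v x ξ)) : u =ᵐ[μ] v := by
  have hd := TopologicalSpace.denseRange_denseSeq H
  have h2 : ∀ᵐ x ∂μ, ∀ i j, inner ℂ (TopologicalSpace.denseSeq H j)
      (u x (TopologicalSpace.denseSeq H i)) = inner ℂ (TopologicalSpace.denseSeq H j)
      (v x (TopologicalSpace.denseSeq H i)) :=
    ae_all_iff.2 fun i => ae_all_iff.2 fun j => h _ _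
  filter_upwards [h2] with x hx
  have h3 : ∀ i, u x (TopologicalSpace.denseSeq H i) = v x (TopologicalSpace.denseSeq H i) :=
    fun i => ext_inner_left ℂ fun η => congrFun (hd.equalizer
      (g := fun η => inner ℂ η (u x (TopologicalSpace.denseSeq H i)))
      (h := fun η => inner ℂ η (v x (TopologicalSpace.denseSeq H i)))
      (by fun_prop) (by fun_prop) (funext fun j => hx i j)) η
  exact DFunLike.coe_injective
    (hd.equalizer (u x).continuous (v x).continuous (funext h3))

end Positivity

/-! ### The map attached to a channel, and its dependence on the class mod `μ`. -/

section Correspondence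

variable {A : Type*} [TopologicalSpace A] [CompactSpace A]
  [MeasurableSpace A] [BorelSpace A]
  {X : Type*} [MeasurableSpace X] {μ : Measure X}
  {H : Type*} [NormedAddCommGroup H] [InnerProductSpace ℂ H] [CompleteSpace H]
  [TopologicalSpace.SeparableSpace H]

omit [TopologicalSpace A] [CompactSpace A] [BorelSpace A] [TopologicalSpace.SeparableSpace H] in
theorem Channel.measurable_coeffInt (E : Channel A H X) (ξ η : H) {f : A → ℂ} (hf : Measurable f)
    (hb : ∃ C, ∀ a, ‖f a‖ ≤ C) : Measurable fun x => (E x).coeffInt ξ η f := by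
  refine bounded_measurable_induction (P := fun f => Measurable fun x => (E x).coeffInt ξ η f)
    ?_ ?_ ?_ f hf hb
  · intro c s hs
    simp only [QuantumMeasure.coeffInt_indicator _ ξ η c hs]
    exact (E.measurable' s hs ξ η).const_mul c
  · intro f g hf hg hfb hgb h1 h2
    simp only [QuantumMeasure.coeffInt_add _ ξ η hf hg hfb hgb]
    exact h1.add h2
  · intro F f C hF hC hlim h
    exact measurable_of_tendsto_metrizable h
      (tendsto_pi_nhds.2 fun x => (E x).tendsto_coeffInt ξ η hF hC hlim)

variable (μ) in
/-- The function `x ↦ ∫ f dE(· | x)`. -/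
def Channel.intFn (E : Channel A H X) (f : C(A, ℂ)) : EssBdd H μ :=
  ⟨fun x => (E x).intCLM f, fun ξ η => by
    simp only [QuantumMeasure.intCLM_apply, QuantumMeasure.inner_intOp_continuousMap]
    exact E.measurable_coeffInt ξ η f.continuous.measurable
      (QuantumMeasure.continuousMap_bounded f), by
    refine lt_of_le_of_lt (essSup_le_of_ae_le (ENNReal.ofReal (2 * ‖f‖))
      (Eventually.of_forall fun x => ?_)) ENNReal.ofReal_lt_top
    change ‖(E x).intCLM f‖ₑ ≤ _
    rw [← ofReal_norm]
    exact ENNReal.ofReal_le_ofReal ((E x).norm_intOp_le f)⟩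

theorem Channel.intFn_apply (E : Channel A H X) (f : C(A, ℂ)) (x : X) :
    (E.intFn μ f : X → H →L[ℂ] H) x = (E x).intCLM f := rfl

variable (μ) in
/-- The map `f ↦ ∫ f dE` from `C(A)` to `L^∞_σ`. -/
def Channel.toCLM (E : Channel A H X) : C(A, ℂ) →L[ℂ] LinftySigma H μ :=
  LinearMap.mkContinuous
    { toFun := fun f => LinftySigma.mk (E.intFn μ f)
      map_add' := fun f g => by
        rw [← LinftySigma.mk_add, LinftySigma.mk_eq_mk]
        exact Eventually.of_forall fun x => map_add (E x).intCLM f g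
      map_smul' := fun c f => by
        rw [RingHom.id_apply, ← LinftySigma.mk_smul, LinftySigma.mk_eq_mk]
        exact Eventually.of_forall fun x => map_smul (E x).intCLM c f } 2
    (fun f => (LinftySigma.norm_mk_le_iff (by positivity)).2
      (Eventually.of_forall fun x => (E x).norm_intOp_le f))

variable (μ) in
/-- The unital completely positive map of a channel. -/
def Channel.toUCP [T2Space A] (E : Channel A H X) : UCP C(A, ℂ) (LinftySigma H μ) :=
  ⟨{ toLinearMap := (E.toCLM μ).toLinearMap
     map_cstarMatrix_nonneg' := map_cstarMatrix_nonneg_of_positive (E.toCLM μ) fun _ hf =>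
      LinftySigma.mk_nonneg (Eventually.of_forall fun x => (E x).isPositive_intOp hf) }, by
    change LinftySigma.mk (E.intFn μ 1) = 1
    rw [← LinftySigma.mk_one, LinftySigma.mk_eq_mk]
    exact Eventually.of_forall fun x => (E x).intOp_one⟩

/-- The exceptional null set in the equivalence depends on `α`, so `E x` and `F x` are not compared
as measures. The induction is run on the almost-everywhere statement itself, which survives sums and
sequential limits. -/
theorem Channel.mk_intFn_congr {E F : Channel A H X} (h : E.toMod μ = F.toMod μ) (f : C(A, ℂ)) :
    LinftySigma.mk (E.intFn μ f) = LinftySigma.mk (F.intFn μ f) := by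
  have hrel : ∀ α, MeasurableSet α → ∀ᵐ x ∂μ, E x α = F x α := Quotient.exact h
  rw [LinftySigma.mk_eq_mk]
  refine ae_eq_of_forall_inner fun ξ η => ?_
  simp only [Channel.intFn_apply, QuantumMeasure.intCLM_apply,
    QuantumMeasure.inner_intOp_continuousMap]
  refine bounded_measurable_induction
    (P := fun f => ∀ᵐ x ∂μ, (E x).coeffInt ξ η f = (F x).coeffInt ξ η f)
    ?_ ?_ ?_ f f.continuous.measurable (QuantumMeasure.continuousMap_bounded f)
  · intro c s hs
    filter_upwards [hrel s hs] with x hx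
    rw [QuantumMeasure.coeffInt_indicator _ ξ η c hs, QuantumMeasure.coeffInt_indicator _ ξ η c hs,
      hx]
  · intro f g hf hg hfb hgb h1 h2
    filter_upwards [h1, h2] with x hx1 hx2
    rw [QuantumMeasure.coeffInt_add _ ξ η hf hg hfb hgb,
      QuantumMeasure.coeffInt_add _ ξ η hf hg hfb hgb, hx1, hx2]
  · intro G f C hG hC hlim h
    filter_upwards [ae_all_iff.2 h] with x hx
    refine tendsto_nhds_unique ((E x).tendsto_coeffInt ξ η hG hC hlim) ?_
    simp only [hx]
    exact (F x).tendsto_coeffInt ξ η hG hC hlim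

theorem isGivenBy_toMod_iff {Φ : UCP C(A, ℂ) (LinftySigma H μ)} {E : Channel A H X} :
    IsGivenBy Φ (E.toMod μ) ↔ ∀ f, Φ.1 f = LinftySigma.mk (E.intFn μ f) := by
  constructor
  · intro h f
    obtain ⟨g, hg⟩ := LinftySigma.mk_surjective (Φ.1 f)
    rw [← hg, LinftySigma.mk_eq_mk]
    refine ae_eq_of_forall_inner fun ξ η => ?_
    filter_upwards [h E rfl f g hg ξ η] with x hx
    rw [hx]
    exact ((E x).inner_intOp_continuousMap f ξ η).symm
  · intro h F hF f g hg ξ η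
    rw [h, ← Channel.mk_intFn_congr hF, LinftySigma.mk_eq_mk] at hg
    filter_upwards [hg] with x hx
    rw [hx]
    exact (F x).inner_intOp_continuousMap f ξ η

/-- Separability of `C(A)` gives more than equivalence: off a single null set, the quantum measures
`E x` and `F x` coincide. -/
theorem Channel.toMod_eq_of_mk_intFn_eq [T2Space A] [SecondCountableTopology A] [HasOuterApproxClosed A]
    {E F : Channel A H X}
    (h : ∀ f, LinftySigma.mk (E.intFn μ f) = LinftySigma.mk (F.intFn μ f)) :
    E.toMod μ = F.toMod μ := by
  have h1 : ∀ᵐ x ∂μ, ∀ n, (E x).intCLM (TopologicalSpace.denseSeq C(A, ℂ) n)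
      = (F x).intCLM (TopologicalSpace.denseSeq C(A, ℂ) n) :=
    ae_all_iff.2 fun n => LinftySigma.mk_eq_mk.1 (h _)
  refine Quotient.sound fun α _ => ?_
  filter_upwards [h1] with x hx
  have h2 : (E x).intCLM = (F x).intCLM := DFunLike.coe_injective
    ((TopologicalSpace.denseRange_denseSeq C(A, ℂ)).equalizer (E x).intCLM.continuous
      (F x).intCLM.continuous (funext hx))
  rw [QuantumMeasure.ext_of_intCLM h2]

end Correspondence

/-! ### Extending approximately linear and positive data from a countable dense set. -/

section Extension

/-- A function on a dense set that is linear up to the Lipschitz bounds of a linear map extends to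
a bounded linear map. -/
theorem exists_clm_extension {V W : Type*} [NormedAddCommGroup V] [NormedSpace ℂ V]
    [NormedAddCommGroup W] [NormedSpace ℂ W] [CompleteSpace W] {D : Set V} (hD : Dense D)
    {Q : Set ℂ} (hQ : Dense Q) {r : V → W} {C : ℝ}
    (hsub : ∀ f ∈ D, ∀ h ∈ D, ‖r f - r h‖ ≤ C * ‖f - h‖)
    (hadd : ∀ f ∈ D, ∀ g ∈ D, ∀ h ∈ D, ‖r f + r g - r h‖ ≤ C * ‖f + g - h‖)
    (hsmul : ∀ q ∈ Q, ∀ f ∈ D, ∀ h ∈ D, ‖q • r f - r h‖ ≤ C * ‖q • f - h‖) :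
    ∃ φ : V →L[ℂ] W, ∀ f ∈ D, φ f = r f := by
  have hlip : LipschitzWith C.toNNReal fun f : D => r f := LipschitzWith.of_dist_le' fun f h => by
    rw [dist_eq_norm, Subtype.dist_eq, dist_eq_norm]
    exact hsub f f.2 h h.2
  let F : V → W := hD.extend fun f : D => r f
  have hFc : Continuous F := (hD.uniformContinuous_extend hlip.uniformContinuous).continuous
  have hF : ∀ f : D, F f = r f := fun f => hD.extend_eq hlip.continuous f
  -- The set `D` need not be closed under sums or scalars. Each algebraic law is stated as an
  -- inequality against a third element `h`, extended by density, and then evaluated where the right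
  -- side vanishes.
  have hadd' : ∀ f g h, ‖F f + F g - F h‖ ≤ C * ‖f + g - h‖ := fun f g h =>
    isClosed_property3 hD.denseRange_val (p := fun f g h => ‖F f + F g - F h‖ ≤ C * ‖f + g - h‖)
      (isClosed_le (by fun_prop) (by fun_prop))
      (fun f g h => by simp only [hF]; exact hadd f f.2 g g.2 h h.2) f g h
  have hsmul' : ∀ (q : Q) f h, ‖(q : ℂ) • F f - F h‖ ≤ C * ‖(q : ℂ) • f - h‖ := fun q f h =>
    isClosed_property2 hD.denseRange_val
      (p := fun f h => ‖(q : ℂ) • F f - F h‖ ≤ C * ‖(q : ℂ) • f - h‖)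
      (isClosed_le (by fun_prop) (by fun_prop))
      (fun f h => by simp only [hF]; exact hsmul q q.2 f f.2 h h.2) f h
  have hsmul'' : ∀ (c : ℂ) f, F (c • f) = c • F f := fun c f =>
    isClosed_property hQ.denseRange_val (p := fun c => F (c • f) = c • F f)
      (isClosed_eq (by fun_prop) (by fun_prop))
      (fun q => by
        have := hsmul' q f ((q : ℂ) • f)
        rw [sub_self, norm_zero, mul_zero, norm_le_zero_iff, sub_eq_zero] at this
        exact this.symm) c
  refine ⟨⟨{ toFun := F, map_add' := fun f g => ?_, map_smul' := hsmul'' }, hFc⟩,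
    fun f hf => hF ⟨f, hf⟩⟩
  have := hadd' f g (f + g)
  rw [sub_self, norm_zero, mul_zero, norm_le_zero_iff, sub_eq_zero] at this
  exact this.symm

variable {A : Type*} [TopologicalSpace A]

theorem exists_eq_star_mul_self_of_nonneg {f : C(A, ℂ)} (hf : 0 ≤ f) : ∃ s, f = star s * s := by
  refine ⟨⟨fun a => (√(f a).re : ℂ), by fun_prop⟩, ?_⟩
  ext a
  obtain ⟨h1, h2⟩ : 0 ≤ (f a).re ∧ 0 = (f a).im := Complex.nonneg_iff.1 (hf a)
  change f a = star (√(f a).re : ℂ) * (√(f a).re : ℂ)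
  rw [Complex.star_def, Complex.conj_ofReal, ← Complex.ofReal_mul, Real.mul_self_sqrt h1]
  exact Complex.ext rfl h2.symm

variable [CompactSpace A]
  {H : Type*} [NormedAddCommGroup H] [InnerProductSpace ℂ H] [CompleteSpace H]

/-- Positivity enters through the witnesses `p f`: the inequality `hpos` forces `φ (star f * f) =
star (p f) * p f` for `f ∈ D`. The functions `star s * s` exhaust the nonnegative ones, so density
and closedness of the cone finish. -/
theorem exists_positive_extension {D : Set C(A, ℂ)} (hD : Dense D) {Q : Set ℂ} (hQ : Dense Q)
    {r p : C(A, ℂ) → H →L[ℂ] H} {C : ℝ}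
    (hsub : ∀ f ∈ D, ∀ h ∈ D, ‖r f - r h‖ ≤ C * ‖f - h‖)
    (hadd : ∀ f ∈ D, ∀ g ∈ D, ∀ h ∈ D, ‖r f + r g - r h‖ ≤ C * ‖f + g - h‖)
    (hsmul : ∀ q ∈ Q, ∀ f ∈ D, ∀ h ∈ D, ‖q • r f - r h‖ ≤ C * ‖q • f - h‖)
    (hpos : ∀ f ∈ D, ∀ h ∈ D, ‖star (p f) * p f - r h‖ ≤ C * ‖star f * f - h‖)
    (hone : ∀ h ∈ D, ‖1 - r h‖ ≤ C * ‖1 - h‖) :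
    ∃ φ : C(A, ℂ) →L[ℂ] H →L[ℂ] H, (∀ f ∈ D, φ f = r f) ∧ φ 1 = 1 ∧
      ∀ f, 0 ≤ f → (φ f).IsPositive := by
  obtain ⟨φ, hφ⟩ := exists_clm_extension hD hQ hsub hadd hsmul
  have key : ∀ (T : H →L[ℂ] H) (u : C(A, ℂ)), (∀ h ∈ D, ‖T - r h‖ ≤ C * ‖u - h‖) → φ u = T := by
    intro T u hT
    have := isClosed_property hD.denseRange_val (p := fun h => ‖T - φ h‖ ≤ C * ‖u - h‖)
      (isClosed_le (by fun_prop) (by fun_prop)) (fun h => by rw [hφ h h.2]; exact hT h h.2) u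
    rw [sub_self, norm_zero, mul_zero, norm_le_zero_iff, sub_eq_zero] at this
    exact this.symm
  refine ⟨φ, hφ, key 1 1 hone, fun f hf => ?_⟩
  obtain ⟨s, rfl⟩ := exists_eq_star_mul_self_of_nonneg hf
  rw [← ContinuousLinearMap.nonneg_iff_isPositive]
  refine isClosed_property hD.denseRange_val (p := fun s => 0 ≤ φ (star s * s)) ?_
    (fun f => ?_) s
  · exact CStarAlgebra.isClosed_nonneg.preimage
      (by fun_prop : Continuous fun s : C(A, ℂ) => φ (star s * s))
  · rw [key _ _ (hpos f f.2)]
    exact star_mul_self_nonneg _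

end Extension

/-! ### From a map into `L^∞_σ` to a channel. -/

section Lifting

variable {A : Type*} [TopologicalSpace A] [CompactSpace A] [T2Space A] [SecondCountableTopology A]
  {X : Type*} [MeasurableSpace X] {μ : Measure X} [IsProbabilityMeasure μ]
  {H : Type*} [NormedAddCommGroup H] [InnerProductSpace ℂ H] [CompleteSpace H]
  [TopologicalSpace.SeparableSpace H]

/-- A unital positive map into `L^∞_σ` is given by a weakly measurable family of unital positive
maps. -/
theorem exists_pointwise_positive (Φ : C(A, ℂ) →L[ℂ] LinftySigma H μ) (h1 : Φ 1 = 1)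
    (hpos : ∀ f, 0 ≤ f → 0 ≤ Φ f) :
    ∃ φ : X → C(A, ℂ) →L[ℂ] H →L[ℂ] H, (∀ x, φ x 1 = 1) ∧
      (∀ x f, 0 ≤ f → (φ x f).IsPositive) ∧ (∀ f, WeaklyMeasurable fun x => φ x f) ∧
      ∀ (f : C(A, ℂ)) (g : EssBdd H μ), LinftySigma.mk g = Φ f →
        ∀ᵐ x ∂μ, (g : X → H →L[ℂ] H) x = φ x f := by
  obtain ⟨D, hDc, hD⟩ := TopologicalSpace.exists_countable_dense C(A, ℂ)
  obtain ⟨Q, hQc, hQ⟩ := TopologicalSpace.exists_countable_dense ℂ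
  choose r hr using fun f => LinftySigma.mk_surjective (Φ f)
  -- Positivity in `L^∞_σ` is made pointwise by factoring `Φ (star f * f)` and choosing a
  -- representative of the factor.
  have hp : ∀ f, ∃ p : EssBdd H μ, LinftySigma.mk (star p * p) = Φ (star f * f) := fun f => by
    obtain ⟨b, hb⟩ := CStarAlgebra.nonneg_iff_eq_star_mul_self.1
      (hpos _ (star_mul_self_nonneg f))
    obtain ⟨p, rfl⟩ := LinftySigma.mk_surjective b
    exact ⟨p, by rw [hb, LinftySigma.mk_mul, LinftySigma.mk_star]⟩
  choose p hp using hp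
  have key : ∀ (u h : C(A, ℂ)) (g : EssBdd H μ), LinftySigma.mk g = Φ u →
      ∀ᵐ x ∂μ, ‖(g : X → H →L[ℂ] H) x - (r h : X → H →L[ℂ] H) x‖ ≤ ‖Φ‖ * ‖u - h‖ := by
    intro u h g hg
    have h2 := LinftySigma.ae_norm_le (g - r h)
    rw [LinftySigma.mk_sub, hg, hr, ← map_sub] at h2
    filter_upwards [h2] with x hx using hx.trans (Φ.le_opNorm _)
  have hgood : ∀ᵐ x ∂μ, ∃ φ : C(A, ℂ) →L[ℂ] H →L[ℂ] H,
      (∀ f ∈ D, φ f = (r f : X → H →L[ℂ] H) x) ∧ φ 1 = 1 ∧ ∀ f, 0 ≤ f → (φ f).IsPositive := by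
    have c1 := (ae_ball_iff hDc).2 fun f _ => (ae_ball_iff hDc).2 fun h _ => key f h (r f) (hr f)
    have c2 := (ae_ball_iff hDc).2 fun f _ => (ae_ball_iff hDc).2 fun g _ =>
      (ae_ball_iff hDc).2 fun h _ => key (f + g) h (r f + r g)
        (by rw [LinftySigma.mk_add, hr, hr, map_add])
    have c3 := (ae_ball_iff hQc).2 fun q _ => (ae_ball_iff hDc).2 fun f _ =>
      (ae_ball_iff hDc).2 fun h _ => key (q • f) h (q • r f)
        (by rw [LinftySigma.mk_smul, hr, map_smul])
    have c4 := (ae_ball_iff hDc).2 fun f _ => (ae_ball_iff hDc).2 fun h _ =>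
      key (star f * f) h (star (p f) * p f) (hp f)
    have c5 := (ae_ball_iff hDc).2 fun h _ => key 1 h 1 (by rw [LinftySigma.mk_one, h1])
    filter_upwards [c1, c2, c3, c4, c5] with x d1 d2 d3 d4 d5
    exact exists_positive_extension hD hQ (r := fun f => (r f : X → H →L[ℂ] H) x)
      (p := fun f => (p f : X → H →L[ℂ] H) x) d1 d2 d3 d4 d5
  obtain ⟨N, hN, hNm, hN0⟩ := exists_measurable_superset_of_null (ae_iff.1 hgood)
  have hNae : ∀ᵐ x ∂μ, x ∉ N := measure_eq_zero_iff_ae_notMem.1 hN0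
  -- A good point exists because `μ` is nonzero. On the null set `N` the map is taken to be one
  -- extending the values at `x₀`, which keeps it unital, positive and measurable in `x`.
  obtain ⟨x₀, hx₀⟩ := hNae.exists
  have hgood' : ∀ x, x ∉ N → ∃ φ : C(A, ℂ) →L[ℂ] H →L[ℂ] H,
      (∀ f ∈ D, φ f = (r f : X → H →L[ℂ] H) x) ∧ φ 1 = 1 ∧ ∀ f, 0 ≤ f → (φ f).IsPositive :=
    fun x hx => not_not.1 fun h => hx (hN h)
  classical
  have hall : ∀ x, ∃ φ : C(A, ℂ) →L[ℂ] H →L[ℂ] H,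
      (∀ f ∈ D, φ f = if x ∈ N then (r f : X → H →L[ℂ] H) x₀ else (r f : X → H →L[ℂ] H) x) ∧
      φ 1 = 1 ∧ ∀ f, 0 ≤ f → (φ f).IsPositive := fun x => by
    by_cases hx : x ∈ N
    · simpa only [if_pos hx] using hgood' x₀ hx₀
    · simpa only [if_neg hx] using hgood' x hx
  choose φ hφD hφ1 hφpos using hall
  refine ⟨φ, hφ1, hφpos, fun f => ?_, fun f g hg => ?_⟩
  · obtain ⟨d, hd, hdf⟩ := mem_closure_iff_seq_limit.1 (hD f)
    intro ξ η
    refine measurable_of_tendsto_metrizable (f := fun n x => inner ℂ η (φ x (d n) ξ))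
      (fun n => ?_) (tendsto_pi_nhds.2 fun x => ?_)
    · have : (fun x => inner ℂ η (φ x (d n) ξ)) = fun x => if x ∈ N
          then inner ℂ η ((r (d n) : X → H →L[ℂ] H) x₀ ξ)
          else inner ℂ η ((r (d n) : X → H →L[ℂ] H) x ξ) := by
        funext x
        rw [hφD x (d n) (hd n)]
        split_ifs <;> rfl
      rw [this]
      exact Measurable.ite hNm measurable_const ((r (d n)).2.1 ξ η)
    · exact ((by fun_prop : Continuous fun u => inner ℂ η (φ x u ξ)).tendsto f).comp hdf
  -- For `f` outside `D`, the representative `g` is compared with `r h` for all `h ∈ D`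
  -- simultaneously; then `h` tends to `f`.
  · have h2 : ∀ᵐ x ∂μ, ∀ h ∈ D,
        ‖(g : X → H →L[ℂ] H) x - (r h : X → H →L[ℂ] H) x‖ ≤ ‖Φ‖ * ‖f - h‖ :=
      (ae_ball_iff hDc).2 fun h _ => key f h g hg
    filter_upwards [h2, hNae] with x hx hxN
    have := isClosed_property hD.denseRange_val
      (p := fun h => ‖(g : X → H →L[ℂ] H) x - φ x h‖ ≤ ‖Φ‖ * ‖f - h‖)
      (isClosed_le (by fun_prop) (by fun_prop))
      (fun h => by rw [hφD x h h.2, if_neg hxN]; exact hx h h.2) f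
    rwa [sub_self, norm_zero, mul_zero, norm_le_zero_iff, sub_eq_zero] at this

variable [MeasurableSpace A] [BorelSpace A]

omit [IsProbabilityMeasure μ] [SecondCountableTopology A] [T2Space A]
  [TopologicalSpace.SeparableSpace H] in
/-- A family of quantum probability measures with weakly measurable integrals of continuous
functions is weakly measurable. -/
theorem weaklyMeasurable_of_intCLM [HasOuterApproxClosed A] {E : X → QuantumMeasure A H}
    (hE : ∀ f, WeaklyMeasurable fun x => (E x).intCLM f) (α : Set A) (hα : MeasurableSet α) :
    WeaklyMeasurable fun x => E x α := by
  -- The induction over Borel sets needs genuine finite measures, hence the diagonal coefficients;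
  -- polarization recovers the others.
  have hdiag : ∀ ξ, Measurable fun x => inner ℂ ξ (E x α ξ) := by
    intro ξ
    suffices h : Measurable fun x => ((E x).meas ξ).real α by
      simp only [← QuantumMeasure.meas_real _ ξ hα]
      exact Complex.measurable_ofReal.comp h
    induction α, hα using MeasurableSpace.induction_on_inter
      ((BorelSpace.measurable_eq (α := A)).trans borel_eq_generateFrom_isClosed)
      isPiSystem_isClosed with
    | empty => simp
    | basic F hF =>
      obtain ⟨f, hf⟩ := exists_seq_tendsto_measureReal hF
      refine measurable_of_tendsto_metrizable (f := fun n x => ∫ a, f n a ∂(E x).meas ξ)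
        (fun n => ?_) (tendsto_pi_nhds.2 fun x => hf _ inferInstance)
      have : (fun x => ∫ a, f n a ∂(E x).meas ξ)
          = fun x => (inner ℂ ξ ((E x).intCLM (complexify (f n)) ξ) : ℂ).re := by
        funext x
        rw [QuantumMeasure.intCLM_apply, QuantumMeasure.inner_self_intOp]
        have h3 : ∫ a, complexify (f n) a ∂(E x).meas ξ
          = ((∫ a, f n a ∂(E x).meas ξ : ℝ) : ℂ) := integral_ofReal
        rw [h3, Complex.ofReal_re]
      rw [this]
      exact Complex.measurable_re.comp (hE _ ξ ξ)
    | compl α hα h =>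
      simp only [measureReal_compl hα, QuantumMeasure.meas_real_univ]
      exact h.const_sub _
    | iUnion α hd hα h =>
      refine measurable_of_tendsto_metrizable
        (f := fun n x => ∑ i ∈ Finset.range n, ((E x).meas ξ).real (α i))
        (fun n => Finset.measurable_fun_sum _ fun i _ => h i)
        (tendsto_pi_nhds.2 fun x => (hasSum_measureReal_iUnion hα hd).tendsto_sum_nat)
  intro ξ η
  simp only [inner_polarization (E _ α) ξ η]
  exact ((((hdiag _).sub (hdiag _)).add ((hdiag _).const_mul _)).sub
    ((hdiag _).const_mul _)).div_const _

/-- Every unital positive map `C(A) → L^∞_σ` comes from a channel. -/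
theorem exists_channel [HasOuterApproxClosed A] (Φ : C(A, ℂ) →L[ℂ] LinftySigma H μ) (h1 : Φ 1 = 1)
    (hpos : ∀ f, 0 ≤ f → 0 ≤ Φ f) :
    ∃ E : Channel A H X, ∀ f, Φ f = LinftySigma.mk (E.intFn μ f) := by
  obtain ⟨φ, hφ1, hφpos, hφm, hφ⟩ := exists_pointwise_positive Φ h1 hpos
  -- Choosing separately at each `x` is harmless: measurability is recovered from the integrals,
  -- which are prescribed by `φ x`.
  choose E hE using fun x => exists_quantumMeasure (φ x) (hφ1 x) (hφpos x)
  refine ⟨⟨E, weaklyMeasurable_of_intCLM fun f => ?_⟩, fun f => ?_⟩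
  · simp only [hE]
    exact hφm f
  · obtain ⟨g, hg⟩ := LinftySigma.mk_surjective (Φ f)
    rw [← hg, LinftySigma.mk_eq_mk]
    filter_upwards [hφ f g hg] with x hx
    rw [hx, Channel.intFn_apply, ← hE x]

end Lifting

end OpChannel

end

theorem mainTheorem9
    {A : Type*} [TopologicalSpace A] [CompactSpace A] [T2Space A] [SecondCountableTopology A]
    [MeasurableSpace A] [BorelSpace A]
    {X : Type*} [TopologicalSpace X] [CompactSpace X] [T2Space X]
    [MeasurableSpace X] [BorelSpace X]
    {H : Type*} [NormedAddCommGroup H] [InnerProductSpace ℂ H] [CompleteSpace H]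
    [TopologicalSpace.SeparableSpace H]
    (μ : Measure X) [IsProbabilityMeasure μ] :
    (∀ Edot : OpChannel.ChannelMod A H μ,
      ∃! Φ : OpChannel.UCP C(A, ℂ) (OpChannel.LinftySigma H μ), OpChannel.IsGivenBy Φ Edot) ∧
    (∀ Φ : OpChannel.UCP C(A, ℂ) (OpChannel.LinftySigma H μ),
      ∃! Edot : OpChannel.ChannelMod A H μ, OpChannel.IsGivenBy Φ Edot) := by
  constructor
  · intro Edot
    obtain ⟨E, rfl⟩ : ∃ E : OpChannel.Channel A H X, E.toMod μ = Edot := Quotient.exists_rep Edot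
    refine ⟨E.toUCP μ, OpChannel.isGivenBy_toMod_iff.2 fun f => rfl, fun Φ hΦ => ?_⟩
    exact Subtype.ext (DFunLike.ext _ _ fun f => OpChannel.isGivenBy_toMod_iff.1 hΦ f)
  · intro Φ
    have hpos : ∀ f, 0 ≤ f → 0 ≤ Φ.1 f := fun f hf => map_nonneg Φ.1 hf
    -- Positive maps between C⋆-algebras are automatically bounded, which supplies the continuity
    -- used in the lifting.
    obtain ⟨C, hC⟩ := PositiveLinearMap.exists_norm_apply_le
      (PositiveLinearMap.mk₀ Φ.1.toLinearMap hpos)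
    obtain ⟨E, hE⟩ := OpChannel.exists_channel
      (Φ.1.toLinearMap.mkContinuous C hC) Φ.2 hpos
    refine ⟨E.toMod μ, OpChannel.isGivenBy_toMod_iff.2 hE, fun Fdot hF => ?_⟩
    obtain ⟨F, rfl⟩ : ∃ F : OpChannel.Channel A H X, F.toMod μ = Fdot := Quotient.exists_rep Fdot
    refine OpChannel.Channel.toMod_eq_of_mk_intFn_eq fun f => ?_
    rw [← OpChannel.isGivenBy_toMod_iff.1 hF f]
    exact hE f
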